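/- Let $K$ be a field and let $0\le n\le \ell$ be integers. The nilHecke algebra $\mathscr H_n^{(0)}$ of type $A$ is the unital associative $K$-algebra with generators $\psi_1,\dots,\psi_{n-1},y_1,\dots,y_n$ and relations $$\psi_r^2=0\ (1\le r<n),\qquad \psi_r\psi_k=\psi_k\psi_r\ (|r-k|>1),\qquad \psi_r\psi_{r+1}\psi_r=\psi_{r+1}\psi_r\psi_{r+1}\ (1\le r<n-1),$$ $$y_ry_k=y_ky_r\ (1\le r,k\le n),\qquad \psi_ry_k=y_k\psi_r\ (1\le r<n,\ k\ne r,r+1),$$ $$\psi_ry_{r+1}=y_r\psi_r+1,\qquad y_{r+1}\psi_r=\psi_ry_r+1\quad(1\le r<n).$$ The cyclotomic nilHecke algebra $\mathscr H_{\ell,n}^{(0)}$ is the quotient of $\mathscr H_n^{(0)}$ by the two-sided ideal generated by $y_1^\ell$ (for $n=0$ there are no generators and no relations, and the algebra is $K$). Let $\mathfrak S_n$ be the symmetric group with simple transpositions $s_i=(i,i+1)$, and for $w\in\mathfrak S_n$ put $\psi_w:=\psi_{i_1}\cdots\psi_{i_k}\in\mathscr H_{\ell,n}^{(0)}$, where $w=s_{i_1}\cdots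 s_{i_k}$ is a reduced expression, that is, one with $k$ minimal. Theorem. The element $\psi_w$ does not depend on the choice of the reduced expression of $w$, and the elements $$\psi_w\,y_1^{a_1}\cdots y_n^{a_n},\qquad w\in\mathfrak S_n,\quad 0\le a_i\le \ell-i\ \text{ for } 1\le i\le n,$$ indexed by the pairs $(w,(a_1,\dots,a_n))$, form a $K$-basis of $\mathscr H_{\ell,n}^{(0)}$. (The case $\ell=n$ was conjectured by Mathas.) -/

import Mathlib

namespace NilHecke

/-- For a 0-based index `r` of a simple transposition, the position `r` in `Fin n`. -/
def lo {n : ℕ} (r : Fin (n - 1)) : Fin n := ⟨r.1, by omega⟩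

/-- For a 0-based index `r` of a simple transposition, the position `r + 1` in `Fin n`. -/
def hi {n : ℕ} (r : Fin (n - 1)) : Fin n := ⟨r.1 + 1, by omega⟩

/-! ### The symmetric group: simple transpositions and reduced expressions -/

/-- The simple transposition interchanging the positions `r` and `r + 1`. -/
def simpleTransp {n : ℕ} (r : Fin (n - 1)) : Equiv.Perm (Fin n) := Equiv.swap (lo r) (hi r)

/-- The product of the simple transpositions along a word. -/
def wordPerm {n : ℕ} (s : List (Fin (n - 1))) : Equiv.Perm (Fin n) :=
  (s.map simpleTransp).prod

/-- `s` is a reduced expression of `w`: its product is `w`, and no shorter word has product `w`. -/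
def IsReducedExpr {n : ℕ} (s : List (Fin (n - 1))) (w : Equiv.Perm (Fin n)) : Prop :=
  wordPerm s = w ∧ ∀ t : List (Fin (n - 1)), wordPerm t = w → s.length ≤ t.length

theorem exists_wordPerm {n : ℕ} (w : Equiv.Perm (Fin n)) :
    ∃ s : List (Fin (n - 1)), wordPerm s = w := by
  cases n with
  | zero => exact ⟨[], Subsingleton.elim _ _⟩
  | succ m =>
    have h : w ∈ Submonoid.closure (Set.range fun i : Fin m ↦ Equiv.swap i.castSucc i.succ) := by
      rw [Equiv.Perm.mclosure_swap_castSucc_succ]; trivial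
    induction h using Submonoid.closure_induction with
    | mem x hx =>
      obtain ⟨i, rfl⟩ := hx
      exact ⟨[i], by simp [wordPerm]; rfl⟩
    | one => exact ⟨[], rfl⟩
    | mul x y _ _ hx hy =>
      obtain ⟨s, rfl⟩ := hx
      obtain ⟨t, rfl⟩ := hy
      exact ⟨s ++ t, by simp [wordPerm]⟩

theorem exists_isReducedExpr {n : ℕ} (w : Equiv.Perm (Fin n)) :
    ∃ s : List (Fin (n - 1)), IsReducedExpr s w := by
  classical
  have h : ∃ k, ∃ s : List (Fin (n - 1)), s.length = k ∧ wordPerm s = w := by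
    obtain ⟨s, hs⟩ := exists_wordPerm w
    exact ⟨s.length, s, rfl, hs⟩
  obtain ⟨s, hk, hs⟩ := Nat.find_spec h
  exact ⟨s, hs, fun t ht ↦ hk ▸ Nat.find_min' h ⟨t, rfl, ht⟩⟩

/-! ### The nilHecke algebra and its cyclotomic quotient -/

/-- The generators `ψ_1, …, ψ_{n-1}` and `y_1, …, y_n` (indexed from `0`). -/
inductive Gen (n : ℕ) : Type
  | psi (r : Fin (n - 1)) : Gen n
  | y (i : Fin n) : Gen n

variable (K : Type*) [Field K]

/-- The generator `ψ_r` in the free algebra. -/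
def freePsi {n : ℕ} (r : Fin (n - 1)) : FreeAlgebra K (Gen n) := FreeAlgebra.ι K (Gen.psi r)

/-- The generator `y_i` in the free algebra. -/
def freeY {n : ℕ} (i : Fin n) : FreeAlgebra K (Gen n) := FreeAlgebra.ι K (Gen.y i)

/-- The defining relations of the nilHecke algebra of type `A`. -/
inductive Rel (n : ℕ) : FreeAlgebra K (Gen n) → FreeAlgebra K (Gen n) → Prop
  | psi_sq (r : Fin (n - 1)) : Rel n (freePsi K r * freePsi K r) 0
  | psi_comm (r k : Fin (n - 1)) (h : k.1 + 1 < r.1) :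
      Rel n (freePsi K r * freePsi K k) (freePsi K k * freePsi K r)
  | braid (r k : Fin (n - 1)) (h : k.1 = r.1 + 1) :
      Rel n (freePsi K r * freePsi K k * freePsi K r) (freePsi K k * freePsi K r * freePsi K k)
  | y_comm (i k : Fin n) : Rel n (freeY K i * freeY K k) (freeY K k * freeY K i)
  | psi_y (r : Fin (n - 1)) (k : Fin n) (h₁ : k ≠ lo r) (h₂ : k ≠ hi r) :
      Rel n (freePsi K r * freeY K k) (freeY K k * freePsi K r)
  | psi_y_hi (r : Fin (n - 1)) :
      Rel n (freePsi K r * freeY K (hi r)) (freeY K (lo r) * freePsi K r + 1)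
  | y_hi_psi (r : Fin (n - 1)) :
      Rel n (freeY K (hi r) * freePsi K r) (freePsi K r * freeY K (lo r) + 1)

/-- The nilHecke algebra of type `A` on `n` strands. -/
abbrev Alg (n : ℕ) : Type _ := RingQuot (Rel K n)

/-- The generator `y_i` of the nilHecke algebra. -/
noncomputable def algY {n : ℕ} (i : Fin n) : Alg K n := RingQuot.mkAlgHom K (Rel K n) (freeY K i)

/-- The generator `ψ_r` of the nilHecke algebra. -/
noncomputable def algPsi {n : ℕ} (r : Fin (n - 1)) : Alg K n :=
  RingQuot.mkAlgHom K (Rel K n) (freePsi K r)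

/-- The cyclotomic relation `y_1 ^ ℓ = 0`; the first `y` is the one with index `0`. -/
inductive CycRel (l n : ℕ) : Alg K n → Alg K n → Prop
  | cyc (i : Fin n) (h : i.1 = 0) : CycRel l n (algY K i ^ l) 0

/-- The cyclotomic nilHecke algebra: the quotient of the nilHecke algebra by the two-sided ideal
generated by `y_1 ^ ℓ`. -/
abbrev Cyc (l n : ℕ) : Type _ := RingQuot (CycRel K l n)

/-- The canonical surjection from the nilHecke algebra to its cyclotomic quotient. -/
noncomputable def proj (l n : ℕ) : Alg K n →ₐ[K] Cyc K l n := RingQuot.mkAlgHom K (CycRel K l n)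

/-- The image of `y_i` in the cyclotomic nilHecke algebra. -/
noncomputable def y (l : ℕ) {n : ℕ} (i : Fin n) : Cyc K l n := proj K l n (algY K i)

/-- The image of `ψ_r` in the cyclotomic nilHecke algebra. -/
noncomputable def psi (l : ℕ) {n : ℕ} (r : Fin (n - 1)) : Cyc K l n := proj K l n (algPsi K r)

/-- The product of the `ψ`-generators along a word. -/
noncomputable def psiWord (l : ℕ) {n : ℕ} (s : List (Fin (n - 1))) : Cyc K l n :=
  (s.map (psi K l)).prod

/-- The element `ψ_w`: the product of the `ψ`-generators along a reduced expression of `w`. -/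
noncomputable def psiPerm (l : ℕ) {n : ℕ} (w : Equiv.Perm (Fin n)) : Cyc K l n :=
  psiWord K l (exists_isReducedExpr w).choose

/-- The monomial `y_1 ^ a_1 ⋯ y_n ^ a_n`, multiplied in this order. -/
noncomputable def yMonomial (l : ℕ) {n : ℕ} (a : Fin n → ℕ) : Cyc K l n :=
  (List.ofFn fun i ↦ y K l i ^ a i).prod

end NilHecke

/-!
The algebra `Cyc K l n` is treated as one instance of an algebra with elements `ψ_r`, `y_j` that
satisfy the nilHecke relations (`IsNilHecke`).

*The elements `ψ_w`.* The number of inversions of a permutation is the length of its reduced words.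
If two reduced words of `w` start with different letters, both letters are descents of `w`, and `w`
has reduced words starting with the two sides of the commutation or braid relation between them; an
induction on the length gives Matsumoto's theorem (`IsNilCoxeter.prod_eq_of_reduced`). The product
along a word that is not reduced vanishes (`IsNilCoxeter.prod_eq_zero`).

*Spanning.* Moving the `y_j` to the right shows that the `ψ_w f`, with `f` a polynomial in the `y_j`,
span. If a polynomial vanishes at the `y_j`, then so does its divided difference
(`IsNilHecke.map_divDiff_eq_zero`). Starting with `y_0 ^ l = 0`, this gives the vanishing of the
complete homogeneous polynomials of degree `l - i` in `y_0, …, y_i` for all `i < n`. The one for `i`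
is monic of degree `l - i` in `y_i`, so division with remainder leaves only the monomials with
exponents `a_i < l - i`.

*Independence of the `ψ_w` over polynomials.* In a relation `∑ ψ_w f_w = 0` let `u` be of minimal
length with `f_u ≠ 0`. Multiplication by `ψ_{w₀ u⁻¹}`, with `w₀` the longest permutation, leaves
`ψ_{w₀} f_u = 0`. Then `ψ_{w₀} g f_u = 0` for all polynomials `g`, and this forces `f_u = 0`
(`IsNilHecke.eq_zero_of_prod_longestWord`): writing `ψ_{w₀}` as `ψ_0 ⋯ ψ_{m-1}` times the element of
the longest permutation of the first `m` positions, the factors are removed one after the other by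
means of `ψ_j y_{j+1} = y_j ψ_j + 1`. This holds in every quotient of the nilHecke algebra.

*Independence of the monomials.* The algebra acts on the quotient of the polynomial ring by the ideal
generated by the above complete homogeneous polynomials: the `ψ_r` act by divided differences, which
preserve this ideal. Applied to the class of `1`, the bounded monomials give the standard monomials,
and these are independent because the quotient maps to an iterated extension in which a root of one
monic polynomial is adjoined at a time (`exists_linearIndependent_stdMonomials`).
-/

namespace NilHecke

/-! ### Inversions and Matsumoto's theorem for the symmetric group -/

section Permutations

variable {n : ℕ}

/-- The inversions of `w`: the pairs of positions `i < j` with `w j < w i`. -/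
def inversions (w : Equiv.Perm (Fin n)) : Finset (Fin n × Fin n) :=
  Finset.univ.filter fun p ↦ p.1 < p.2 ∧ w p.2 < w p.1

theorem mem_inversions {w : Equiv.Perm (Fin n)} {p : Fin n × Fin n} :
    p ∈ inversions w ↔ p.1 < p.2 ∧ w p.2 < w p.1 := by
  simp [inversions]

@[simp] theorem lo_val (r : Fin (n - 1)) : (lo r).1 = r.1 := rfl

@[simp] theorem hi_val (r : Fin (n - 1)) : (hi r).1 = r.1 + 1 := rfl

theorem simpleTransp_mul_self (r : Fin (n - 1)) : simpleTransp r * simpleTransp r = 1 := by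
  simp [simpleTransp]

theorem simpleTransp_mul_cancel (r : Fin (n - 1)) (w : Equiv.Perm (Fin n)) :
    simpleTransp r * (simpleTransp r * w) = w := by
  rw [← mul_assoc, simpleTransp_mul_self, one_mul]

theorem simpleTransp_inv (r : Fin (n - 1)) : (simpleTransp r)⁻¹ = simpleTransp r := by
  simp [simpleTransp]

theorem simpleTransp_lo (r : Fin (n - 1)) : simpleTransp r (lo r) = hi r :=
  Equiv.swap_apply_left _ _

theorem simpleTransp_hi (r : Fin (n - 1)) : simpleTransp r (hi r) = lo r :=
  Equiv.swap_apply_right _ _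

theorem simpleTransp_val (r : Fin (n - 1)) (i : Fin n) :
    (simpleTransp r i).1 = Equiv.swap r.1 (r.1 + 1) i.1 := by
  simp only [simpleTransp, Equiv.swap_apply_def, Fin.ext_iff, lo_val, hi_val]
  split_ifs <;> rfl

theorem simpleTransp_of_ne {r : Fin (n - 1)} {i : Fin n} (h₁ : i.1 ≠ r.1) (h₂ : i.1 ≠ r.1 + 1) :
    simpleTransp r i = i :=
  Equiv.swap_apply_of_ne_of_ne (fun h ↦ h₁ (by simp [h])) (fun h ↦ h₂ (by simp [h]))

/-- A simple transposition preserves the relative order of all pairs but one. -/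
theorem simpleTransp_lt_iff {r : Fin (n - 1)} {a b : Fin n} (h₁ : ¬(a = lo r ∧ b = hi r))
    (h₂ : ¬(a = hi r ∧ b = lo r)) : simpleTransp r a < simpleTransp r b ↔ a < b := by
  simp only [Fin.lt_def, simpleTransp_val, Equiv.swap_apply_def, Fin.ext_iff, lo_val, hi_val] at *
  split_ifs <;> omega

theorem inversions_simpleTransp_mul {w : Equiv.Perm (Fin n)} {r : Fin (n - 1)}
    (h : w⁻¹ (lo r) < w⁻¹ (hi r)) :
    inversions (simpleTransp r * w) = insert (w⁻¹ (lo r), w⁻¹ (hi r)) (inversions w) := by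
  ext ⟨i, j⟩
  simp only [Finset.mem_insert, mem_inversions, Equiv.Perm.mul_apply, Prod.mk.injEq,
    Equiv.Perm.eq_inv_iff_eq]
  have hlt : lo r < hi r := by simp [Fin.lt_def]
  by_cases h₁ : w i = lo r ∧ w j = hi r
  · have hij : i < j := by
      rw [← h₁.1, ← h₁.2] at h
      simpa using h
    simp [h₁.1, h₁.2, simpleTransp_lo, simpleTransp_hi, hlt, hij]
  · by_cases h₂ : w i = hi r ∧ w j = lo r
    · have hij : j < i := by
        rw [← h₂.1, ← h₂.2] at h
        simpa using h
      simp [h₂.1, h₂.2, hij.le, hlt.ne']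
    · rw [simpleTransp_lt_iff (fun h ↦ h₂ ⟨h.2, h.1⟩) (fun h ↦ h₁ ⟨h.2, h.1⟩)]
      simp [h₁]

theorem card_inversions_of_lt {w : Equiv.Perm (Fin n)} {r : Fin (n - 1)}
    (h : w⁻¹ (lo r) < w⁻¹ (hi r)) :
    (inversions (simpleTransp r * w)).card = (inversions w).card + 1 := by
  rw [inversions_simpleTransp_mul h, Finset.card_insert_of_notMem]
  simp [mem_inversions, Fin.le_def]

theorem card_inversions_of_gt {w : Equiv.Perm (Fin n)} {r : Fin (n - 1)}
    (h : w⁻¹ (hi r) < w⁻¹ (lo r)) :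
    (inversions (simpleTransp r * w)).card + 1 = (inversions w).card := by
  have := card_inversions_of_lt (w := simpleTransp r * w) (r := r)
    (by simpa [simpleTransp_inv, simpleTransp_lo, simpleTransp_hi] using h)
  rw [← this, simpleTransp_mul_cancel]

theorem inv_lt_or_gt (w : Equiv.Perm (Fin n)) (r : Fin (n - 1)) :
    w⁻¹ (lo r) < w⁻¹ (hi r) ∨ w⁻¹ (hi r) < w⁻¹ (lo r) := by
  refine lt_or_gt_of_ne fun h ↦ ?_
  have := congrArg Fin.val (w⁻¹.injective h)
  simp at this

@[simp] theorem wordPerm_cons (r : Fin (n - 1)) (s : List (Fin (n - 1))) :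
    wordPerm (r :: s) = simpleTransp r * wordPerm s := by
  simp [wordPerm]

@[simp] theorem wordPerm_append (s t : List (Fin (n - 1))) :
    wordPerm (s ++ t) = wordPerm s * wordPerm t := by
  simp [wordPerm]

theorem card_inversions_le_length (s : List (Fin (n - 1))) :
    (inversions (wordPerm s)).card ≤ s.length := by
  induction s with
  | nil =>
    have : inversions (wordPerm ([] : List (Fin (n - 1)))) = ∅ := by
      ext p
      simp only [mem_inversions, wordPerm, List.map_nil, List.prod_nil, Equiv.Perm.one_apply,
        Finset.notMem_empty, iff_false]
      exact fun h ↦ lt_asymm h.1 h.2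
    simp [this]
  | cons r s ih =>
    rw [wordPerm_cons, List.length_cons]
    rcases inv_lt_or_gt (wordPerm s) r with h | h
    · have := card_inversions_of_lt h
      omega
    · have := card_inversions_of_gt h
      omega

/-- A permutation without descents is increasing, hence trivial. -/
theorem eq_one_of_forall_lt {w : Equiv.Perm (Fin n)}
    (h : ∀ r : Fin (n - 1), w⁻¹ (lo r) < w⁻¹ (hi r)) : w = 1 := by
  cases n with
  | zero => exact Subsingleton.elim _ _
  | succ m =>
    have hm : StrictMono (w⁻¹ : Equiv.Perm (Fin (m + 1))) :=
      Fin.strictMono_iff_lt_succ.2 fun i ↦ h i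
    have : w⁻¹ = 1 := by
      ext i
      exact congrArg Fin.val (DFunLike.congr_fun (Subsingleton.elim
        (hm.orderIsoOfSurjective _ w⁻¹.surjective) (OrderIso.refl _)) i)
    simpa using this

theorem exists_word_length_eq (w : Equiv.Perm (Fin n)) :
    ∃ s : List (Fin (n - 1)), wordPerm s = w ∧ s.length = (inversions w).card := by
  induction hk : (inversions w).card generalizing w with
  | zero =>
    refine ⟨[], ?_, rfl⟩
    rw [eq_one_of_forall_lt (w := w) fun r ↦ ?_]
    · rfl
    · refine (inv_lt_or_gt w r).resolve_right fun h ↦ ?_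
      have := card_inversions_of_gt h
      omega
  | succ k ih =>
    obtain ⟨r, hr⟩ : ∃ r : Fin (n - 1), w⁻¹ (hi r) < w⁻¹ (lo r) := by
      by_contra! hne
      have h1 := eq_one_of_forall_lt (w := w) fun r ↦
        (inv_lt_or_gt w r).resolve_right (hne r).not_gt
      have h2 := card_inversions_le_length ([] : List (Fin (n - 1)))
      have h3 : wordPerm ([] : List (Fin (n - 1))) = w := h1.symm
      rw [h3, hk] at h2
      simp at h2
    obtain ⟨s, hs, hl⟩ := ih (simpleTransp r * w) (by have := card_inversions_of_gt hr; omega)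
    exact ⟨r :: s, by rw [wordPerm_cons, hs, simpleTransp_mul_cancel], by simp [hl]⟩

theorem IsReducedExpr.length_eq {s : List (Fin (n - 1))} {w : Equiv.Perm (Fin n)}
    (h : IsReducedExpr s w) : s.length = (inversions w).card := by
  obtain ⟨t, ht, hl⟩ := exists_word_length_eq w
  exact le_antisymm (hl ▸ h.2 t ht) (h.1 ▸ card_inversions_le_length s)

theorem simpleTransp_comm {r q : Fin (n - 1)} (h : q.1 + 1 < r.1) :
    simpleTransp r * simpleTransp q = simpleTransp q * simpleTransp r := by
  ext i
  simp only [Equiv.Perm.mul_apply, simpleTransp_val, Equiv.swap_apply_def]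
  split_ifs <;> omega

theorem simpleTransp_braid {r q : Fin (n - 1)} (h : q.1 = r.1 + 1) :
    simpleTransp r * simpleTransp q * simpleTransp r =
      simpleTransp q * simpleTransp r * simpleTransp q := by
  have hqr : lo q = hi r := Fin.ext h
  have h₁ : lo r ≠ hi r := by simp [Fin.ext_iff]
  have h₂ : hi q ≠ hi r := by simp [Fin.ext_iff, h]
  have h₃ : lo r ≠ hi q := by simp [Fin.ext_iff, h, add_assoc]
  simp only [simpleTransp, hqr]
  rw [Equiv.swap_mul_swap_mul_swap h₁ h₃, Equiv.swap_comm (lo r), Equiv.swap_comm (hi r) (hi q),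
    Equiv.swap_mul_swap_mul_swap h₂ h₃.symm, Equiv.swap_comm]

end Permutations

section NilCoxeter

variable {n : ℕ} {A : Type*} [Ring A]

/-- The relations of the nilCoxeter algebra of the symmetric group. -/
structure IsNilCoxeter (p : Fin (n - 1) → A) : Prop where
  sq : ∀ r, p r * p r = 0
  comm : ∀ r q : Fin (n - 1), q.1 + 1 < r.1 → p r * p q = p q * p r
  braid : ∀ r q : Fin (n - 1), q.1 = r.1 + 1 → p r * p q * p r = p q * p r * p q

variable {p : Fin (n - 1) → A}

/-- Two reduced words that start with different letters, both descents of the same permutation, are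
compared through reduced words that start with the two sides of a commutation or braid relation. -/
theorem IsNilCoxeter.prod_cons_eq (hp : IsNilCoxeter p) {r q : Fin (n - 1)} (hrq : q.1 < r.1)
    {s t : List (Fin (n - 1))} (hst : wordPerm (r :: s) = wordPerm (q :: t))
    (hs : (r :: s).length = (inversions (wordPerm (r :: s))).card)
    (ht : t.length = s.length)
    (ih : ∀ s' t' : List (Fin (n - 1)), s'.length = s.length → t'.length = s.length →
      s'.length = (inversions (wordPerm s')).card → wordPerm s' = wordPerm t' →
      (s'.map p).prod = (t'.map p).prod) :
    p r * (s.map p).prod = p q * (t.map p).prod := by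
  set w := wordPerm (r :: s) with hw
  have hsw : wordPerm s = simpleTransp r * w := by rw [hw, wordPerm_cons, simpleTransp_mul_cancel]
  have htw : wordPerm t = simpleTransp q * w := by rw [hst, wordPerm_cons, simpleTransp_mul_cancel]
  have hs1 := card_inversions_le_length s
  have ht1 := card_inversions_le_length t
  rw [hsw] at hs1
  rw [htw] at ht1
  rw [List.length_cons] at hs
  have hr : w⁻¹ (hi r) < w⁻¹ (lo r) := by
    refine (inv_lt_or_gt w r).resolve_left fun h ↦ ?_
    have := card_inversions_of_lt h
    omega
  have hq : w⁻¹ (hi q) < w⁻¹ (lo q) := by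
    refine (inv_lt_or_gt w q).resolve_left fun h ↦ ?_
    have := card_inversions_of_lt h
    omega
  have hcr := card_inversions_of_gt hr
  have hcq := card_inversions_of_gt hq
  by_cases hadj : r.1 = q.1 + 1
  · have hlr : lo r = hi q := Fin.ext (by simp [hadj])
    have e1 : simpleTransp q (hi r) = hi r := simpleTransp_of_ne (by simp; omega) (by simp; omega)
    have e2 : simpleTransp r (lo q) = lo q := simpleTransp_of_ne (by simp; omega) (by simp; omega)
    have h1 : (simpleTransp q * w)⁻¹ (hi r) < (simpleTransp q * w)⁻¹ (lo r) := by
      simp only [mul_inv_rev, simpleTransp_inv, Equiv.Perm.mul_apply, e1, hlr, simpleTransp_hi]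
      exact (hlr ▸ hr).trans hq
    have c1 := card_inversions_of_gt h1
    have h2 : (simpleTransp r * (simpleTransp q * w))⁻¹ (hi q) <
        (simpleTransp r * (simpleTransp q * w))⁻¹ (lo q) := by
      simp only [mul_inv_rev, simpleTransp_inv, Equiv.Perm.mul_apply, e2, ← hlr, simpleTransp_lo,
        e1]
      rwa [hlr, ← hlr]
    have c2 := card_inversions_of_gt h2
    obtain ⟨x, hx, hxl⟩ := exists_word_length_eq
      (simpleTransp q * (simpleTransp r * (simpleTransp q * w)))
    have hb := simpleTransp_braid hadj
    have hxt : wordPerm t = wordPerm (r :: q :: x) := by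
      simp only [wordPerm_cons, hx, htw, simpleTransp_mul_cancel]
    have hxs : wordPerm s = wordPerm (q :: r :: x) := by
      simp only [wordPerm_cons, hx, hsw]
      rw [← mul_assoc (simpleTransp q) (simpleTransp r), ← mul_assoc (_ * _) (simpleTransp q), hb]
      simp only [mul_assoc, simpleTransp_mul_cancel]
    rw [ih s (q :: r :: x) rfl (by simp; omega) (by rw [hsw]; omega) hxs,
      ih t (r :: q :: x) ht (by simp; omega) (by rw [htw]; omega) hxt]
    simp only [List.map_cons, List.prod_cons, ← mul_assoc]
    rw [hp.braid q r hadj]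
  · have e1 : simpleTransp q (hi r) = hi r := simpleTransp_of_ne (by simp; omega) (by simp; omega)
    have e2 : simpleTransp q (lo r) = lo r := simpleTransp_of_ne (by simp; omega) (by simp; omega)
    have h1 : (simpleTransp q * w)⁻¹ (hi r) < (simpleTransp q * w)⁻¹ (lo r) := by
      simpa only [mul_inv_rev, simpleTransp_inv, Equiv.Perm.mul_apply, e1, e2] using hr
    have c1 := card_inversions_of_gt h1
    obtain ⟨x, hx, hxl⟩ := exists_word_length_eq (simpleTransp r * (simpleTransp q * w))
    have hc := simpleTransp_comm (r := r) (q := q) (by omega)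
    have hxt : wordPerm t = wordPerm (r :: x) := by
      simp only [wordPerm_cons, hx, htw, simpleTransp_mul_cancel]
    have hxs : wordPerm s = wordPerm (q :: x) := by
      simp only [wordPerm_cons, hx, hsw]
      rw [← mul_assoc (simpleTransp r), hc, mul_assoc, simpleTransp_mul_cancel]
    rw [ih s (q :: x) rfl (by simp; omega) (by rw [hsw]; omega) hxs,
      ih t (r :: x) ht (by simp; omega) (by rw [htw]; omega) hxt]
    simp only [List.map_cons, List.prod_cons, ← mul_assoc]
    rw [hp.comm r q (by omega)]

/-- Matsumoto's theorem for the symmetric group: the product along a reduced word depends only on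
the permutation. -/
theorem IsNilCoxeter.prod_eq_of_reduced (hp : IsNilCoxeter p) {s t : List (Fin (n - 1))}
    (hs : s.length = (inversions (wordPerm s)).card) (hst : wordPerm s = wordPerm t)
    (ht : t.length = s.length) : (s.map p).prod = (t.map p).prod := by
  induction hk : s.length generalizing s t with
  | zero =>
    rw [List.eq_nil_of_length_eq_zero hk, List.eq_nil_of_length_eq_zero (ht.trans hk)]
  | succ k ih =>
    obtain ⟨r, s, rfl⟩ := List.exists_cons_of_length_eq_add_one hk
    obtain ⟨q, t, rfl⟩ := List.exists_cons_of_length_eq_add_one (ht.trans hk)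
    simp only [List.length_cons, Nat.add_right_cancel_iff] at hk ht
    have ih' : ∀ s' t' : List (Fin (n - 1)), s'.length = s.length → t'.length = s.length →
        s'.length = (inversions (wordPerm s')).card → wordPerm s' = wordPerm t' →
        (s'.map p).prod = (t'.map p).prod :=
      fun s' t' h1 h2 h3 h4 ↦ ih h3 h4 (h2.trans h1.symm) (h1.trans hk)
    simp only [List.map_cons, List.prod_cons]
    rcases lt_trichotomy q.1 r.1 with h | h | h
    · exact hp.prod_cons_eq h hst hs ht ih'
    · obtain rfl : q = r := Fin.ext h
      rw [wordPerm_cons, wordPerm_cons, mul_right_inj] at hst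
      rw [ih' s t rfl ht ?_ hst]
      rw [wordPerm_cons, List.length_cons] at hs
      have h1 := card_inversions_le_length s
      rcases inv_lt_or_gt (wordPerm s) q with h | h
      · have := card_inversions_of_lt h
        omega
      · have := card_inversions_of_gt h
        omega
    · refine (hp.prod_cons_eq h hst.symm ?_ ht.symm ?_).symm
      · rw [← hst, ← hs, List.length_cons, List.length_cons, ht]
      · rw [ht]
        exact ih'

theorem IsNilCoxeter.prod_eq_zero (hp : IsNilCoxeter p) {s : List (Fin (n - 1))}
    (hs : (inversions (wordPerm s)).card < s.length) : (s.map p).prod = 0 := by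
  induction s with
  | nil => simp at hs
  | cons r s ih =>
    rw [List.map_cons, List.prod_cons]
    rcases (card_inversions_le_length s).lt_or_eq with h | h
    · rw [ih h, mul_zero]
    · rw [wordPerm_cons, List.length_cons] at hs
      have hr : (wordPerm s)⁻¹ (hi r) < (wordPerm s)⁻¹ (lo r) := by
        refine (inv_lt_or_gt _ r).resolve_left fun h ↦ ?_
        have := card_inversions_of_lt h
        omega
      obtain ⟨x, hx, hxl⟩ := exists_word_length_eq (simpleTransp r * wordPerm s)
      have := card_inversions_of_gt hr
      -- A word beginning with the descent `r` computes the same product, and `p r ^ 2 = 0`.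
      rw [hp.prod_eq_of_reduced (t := r :: x) h.symm
        (by rw [wordPerm_cons, hx, simpleTransp_mul_cancel]) (by simp; omega),
        List.map_cons, List.prod_cons, ← mul_assoc, hp.sq, zero_mul]

end NilCoxeter

/-! ### Complete homogeneous symmetric polynomials in initial segments of the variables -/

section CompleteHomogeneous

variable {R : Type*} [CommRing R]

/-- The complete homogeneous symmetric polynomial of degree `d` evaluated at `x 0, …, x (i - 1)`,
expanded in powers of the last of these elements. -/
def complHom (x : ℕ → R) : ℕ → ℕ → R
  | 0, d => if d = 0 then 1 else 0
  | i + 1, d => ∑ k ∈ Finset.range (d + 1), complHom x i (d - k) * x i ^ k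

theorem complHom_zero_succ (x : ℕ → R) (d : ℕ) : complHom x 0 (d + 1) = 0 := by
  simp [complHom]

@[simp] theorem complHom_zero_right (x : ℕ → R) (i : ℕ) : complHom x i 0 = 1 := by
  induction i with
  | zero => simp [complHom]
  | succ i ih => simp [complHom, ih]

theorem complHom_succ_succ (x : ℕ → R) (i d : ℕ) :
    complHom x (i + 1) (d + 1) = complHom x i (d + 1) + x i * complHom x (i + 1) d := by
  rw [complHom, Finset.sum_range_succ', add_comm, complHom, Finset.mul_sum]
  congr 1
  · simp
  · refine Finset.sum_congr rfl fun k _ ↦ ?_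
    rw [Nat.add_sub_add_right, pow_succ']
    ring

theorem complHom_one (x : ℕ → R) (d : ℕ) : complHom x 1 d = x 0 ^ d := by
  induction d with
  | zero => simp
  | succ d ih => rw [complHom_succ_succ, complHom_zero_succ, ih, zero_add, pow_succ']

theorem complHom_congr {x x' : ℕ → R} {i : ℕ} (h : ∀ j < i, x j = x' j) (d : ℕ) :
    complHom x i d = complHom x' i d := by
  induction i generalizing d with
  | zero => rfl
  | succ i ih =>
    simp only [complHom, h i i.lt_succ_self, ih fun j hj ↦ h j (hj.trans i.lt_succ_self)]

theorem map_complHom {S F : Type*} [CommRing S] [FunLike F R S] [RingHomClass F R S] (f : F)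
    (x : ℕ → R) (i d : ℕ) : f (complHom x i d) = complHom (fun j ↦ f (x j)) i d := by
  induction i generalizing d with
  | zero => simp [complHom, apply_ite f]
  | succ i ih => simp [complHom, map_sum, ih]

/-- Replacing the last variable `x r` by `x (r + 1)` changes a complete homogeneous polynomial by a
multiple of `x (r + 1) - x r`. -/
theorem complHom_sub_complHom {x x' : ℕ → R} {r : ℕ} (h : ∀ j < r, x' j = x j)
    (hr : x' r = x (r + 1)) (d : ℕ) :
    complHom x' (r + 1) (d + 1) - complHom x (r + 1) (d + 1) =
      (x (r + 1) - x r) * complHom x (r + 2) d := by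
  induction d with
  | zero => simp [complHom_succ_succ, hr, complHom_congr h]
  | succ d ih =>
    rw [complHom_succ_succ x', complHom_succ_succ x r, complHom_succ_succ x (r + 1),
      complHom_congr h, hr]
    linear_combination x (r + 1) * ih

end CompleteHomogeneous

/-! ### Standard monomials -/

section StandardMonomials

variable (K : Type*) [Field K]

/-- A product of powers `x i ^ a i`, `i < m`, with exponents `a i < l - i`. -/
def IsStdMonomial {R : Type*} [CommRing R] (x : ℕ → R) (l m : ℕ) (z : R) : Prop :=
  ∃ a : ℕ → ℕ, (∀ i < m, a i < l - i) ∧ z = ∏ i ∈ Finset.range m, x i ^ a i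

theorem IsStdMonomial.mul_pow {R : Type*} [CommRing R] {x : ℕ → R} {l m k : ℕ} {z : R}
    (hz : IsStdMonomial x l m z) (hk : k < l - m) : IsStdMonomial x l (m + 1) (z * x m ^ k) := by
  obtain ⟨a, ha, rfl⟩ := hz
  refine ⟨Function.update a m k, fun i hi ↦ ?_, ?_⟩
  · rcases eq_or_ne i m with rfl | h
    · simpa
    · simpa [h] using ha i (by omega)
  · rw [Finset.prod_range_succ, Function.update_self]
    congr 1
    refine Finset.prod_congr rfl fun i hi ↦ ?_
    rw [Function.update_of_ne (Finset.mem_range.1 hi).ne]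

theorem complHom_mem_adjoin {R : Type*} [CommRing R] [Algebra K R] (x : ℕ → R) {i m : ℕ}
    (h : i ≤ m) (d : ℕ) : complHom x i d ∈ Algebra.adjoin K (x '' Set.Iio m) := by
  induction i generalizing d with
  | zero =>
    simp only [complHom]
    split_ifs
    · exact one_mem _
    · exact zero_mem _
  | succ i ih =>
    exact sum_mem fun k _ ↦ mul_mem (ih (by omega) _)
      (pow_mem (Algebra.subset_adjoin (Set.mem_image_of_mem x (Set.mem_Iio.2 h))) _)

/-- If the complete homogeneous polynomials of degree `l - i` in `x 0, …, x i` vanish, then the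
standard monomials span the algebra generated by the `x i`: the relation for `i` is monic of degree
`l - i` in `x i`, hence allows division with remainder. -/
theorem mem_span_isStdMonomial {R : Type*} [CommRing R] [Algebra K R] (x : ℕ → R) {l m : ℕ}
    (hm : m ≤ l) (hx : ∀ i < m, complHom x (i + 1) (l - i) = 0) {z : R}
    (hz : z ∈ Algebra.adjoin K (x '' Set.Iio m)) :
    z ∈ Submodule.span K {z | IsStdMonomial x l m z} := by
  induction m generalizing z with
  | zero =>
    rw [Set.Iio_eq_empty_iff.2 (by simp), Set.image_empty, Algebra.adjoin_empty,
      Algebra.mem_bot] at hz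
    obtain ⟨c, rfl⟩ := hz
    rw [Algebra.algebraMap_eq_smul_one]
    exact Submodule.smul_mem _ _ (Submodule.subset_span ⟨0, by simp, by simp⟩)
  | succ m ih =>
    set B := Algebra.adjoin K (x '' Set.Iio m) with hB
    set N := Submodule.span K {z | ∃ b ∈ B, ∃ k < l - m, z = b * x m ^ k} with hN
    have hmem : ∀ b ∈ B, ∀ k < l - m, b * x m ^ k ∈ N :=
      fun b hb k hk ↦ Submodule.subset_span ⟨b, hb, k, hk, rfl⟩
    have hNle : N ≤ Submodule.span K {z | IsStdMonomial x l (m + 1) z} := by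
      rw [hN, Submodule.span_le]
      rintro _ ⟨b, hb, k, hk, rfl⟩
      have hb' := ih (by omega) (fun i hi ↦ hx i (by omega)) hb
      clear hb
      induction hb' using Submodule.span_induction with
      | mem z hz => exact Submodule.subset_span (hz.mul_pow hk)
      | zero => simp
      | add z z' _ _ h h' => rw [add_mul]; exact add_mem h h'
      | smul c z _ h => rw [smul_mul_assoc]; exact Submodule.smul_mem _ _ h
    -- Multiplication by `x m` raises the exponent; the top power is reduced by the relation.
    have hgen : ∀ b ∈ B, ∀ k < l - m, x m * (b * x m ^ k) ∈ N := by
      intro b hb k hk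
      rcases Nat.lt_or_ge (k + 1) (l - m) with h | h
      · rw [mul_left_comm, ← pow_succ']
        exact hmem b hb _ h
      · have hrel := hx m m.lt_succ_self
        obtain rfl : k = l - m - 1 := by omega
        rw [complHom, Finset.sum_range_succ, Nat.sub_self, complHom_zero_right, one_mul,
          add_eq_zero_iff_eq_neg'] at hrel
        rw [mul_left_comm, ← pow_succ', Nat.sub_add_cancel (by omega), hrel, mul_neg,
          Finset.mul_sum]
        refine neg_mem (sum_mem fun j hj ↦ ?_)
        rw [← mul_assoc]
        exact hmem _ (mul_mem hb (complHom_mem_adjoin K x le_rfl _)) _ (Finset.mem_range.1 hj)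
    have hstable : ∀ a ∈ Algebra.adjoin K (x '' Set.Iio (m + 1)), ∀ z ∈ N, a * z ∈ N := by
      intro a ha
      induction ha using Algebra.adjoin_induction with
      | mem a ha =>
        obtain ⟨i, hi, rfl⟩ := ha
        intro z hz
        induction hz using Submodule.span_induction with
        | mem z hz =>
          obtain ⟨b, hb, k, hk, rfl⟩ := hz
          rcases (Nat.lt_succ_iff.1 hi).lt_or_eq with h | rfl
          · rw [← mul_assoc]
            exact hmem _ (mul_mem (Algebra.subset_adjoin ⟨i, h, rfl⟩) hb) _ hk
          · exact hgen b hb k hk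
        | zero => simp
        | add z z' _ _ h h' => rw [mul_add]; exact add_mem h h'
        | smul c z _ h => rw [mul_smul_comm]; exact Submodule.smul_mem _ _ h
      | algebraMap c =>
        intro z hz
        rw [← Algebra.smul_def]
        exact Submodule.smul_mem _ _ hz
      | add a b _ _ h h' =>
        intro z hz
        rw [add_mul]
        exact add_mem (h z hz) (h' z hz)
      | mul a b _ _ h h' =>
        intro z hz
        rw [mul_assoc]
        exact h _ (h' z hz)
    have h1 : (1 : R) ∈ N := by simpa using hmem 1 (one_mem _) 0 (by omega)
    simpa using hNle (hstable z hz 1 h1)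

/-- A commutative algebra in which the complete homogeneous polynomials of degree `l - i` in
`x 0, …, x i` vanish for `i < m` and the standard monomials are linearly independent, built by
adjoining one root of a monic polynomial at a time. -/
theorem exists_linearIndependent_stdMonomials.{u} {K : Type u} [Field K] {l m : ℕ} (hm : m ≤ l) :
    ∃ (R : Type u) (_ : CommRing R) (_ : Algebra K R) (x : ℕ → R),
      (∀ i < m, complHom x (i + 1) (l - i) = 0) ∧
      LinearIndependent K fun a : {a : Fin m → ℕ // ∀ i, a i < l - i.1} ↦
        ∏ i : Fin m, x i ^ a.1 i := by
  induction m with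
  | zero =>
    refine ⟨K, inferInstance, inferInstance, 0, by simp, ?_⟩
    have : Unique {a : Fin 0 → ℕ // ∀ i, a i < l - i.1} :=
      ⟨⟨⟨0, fun i ↦ i.elim0⟩⟩, fun a ↦ Subsingleton.elim _ _⟩
    rw [linearIndependent_unique_iff]
    simp
  | succ m ih =>
    obtain ⟨R, _, _, x, hx, hlin⟩ := ih (by omega)
    have hnt : Nontrivial R := by
      by_contra h
      rw [not_nontrivial_iff_subsingleton] at h
      exact hlin.ne_zero ⟨0, fun i ↦ by simp; omega⟩ (Subsingleton.elim _ _)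
    let f : Polynomial R :=
      ∑ k ∈ Finset.range (l - m + 1), Polynomial.C (complHom x m (l - m - k)) * Polynomial.X ^ k
    have hlead : f = Polynomial.X ^ (l - m) + ∑ k ∈ Finset.range (l - m),
        Polynomial.C (complHom x m (l - m - k)) * Polynomial.X ^ k := by
      simp [f, Finset.sum_range_succ, add_comm]
    have hdeg : (∑ k ∈ Finset.range (l - m),
        Polynomial.C (complHom x m (l - m - k)) * Polynomial.X ^ k).degree < ((l - m : ℕ) : WithBot ℕ) := by
      refine (Polynomial.degree_sum_le _ _).trans_lt
        ((Finset.sup_lt_iff (WithBot.bot_lt_coe _)).2 fun k hk ↦ ?_)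
      exact (Polynomial.degree_C_mul_X_pow_le _ _).trans_lt
        (WithBot.coe_lt_coe.2 (Finset.mem_range.1 hk))
    have hmonic : f.Monic := hlead ▸ Polynomial.monic_X_pow_add hdeg
    have hnat : f.natDegree = l - m := by
      rw [hlead, Polynomial.natDegree_eq_of_degree_eq_some]
      rw [Polynomial.degree_add_eq_left_of_degree_lt] <;> simp [hdeg]
    let x' : ℕ → AdjoinRoot f :=
      fun j ↦ if j < m then algebraMap R (AdjoinRoot f) (x j) else AdjoinRoot.root f
    have hx' : ∀ i ≤ m, ∀ d, complHom x' i d = algebraMap R (AdjoinRoot f) (complHom x i d) := by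
      intro i hi d
      rw [map_complHom]
      exact complHom_congr (fun j hj ↦ if_pos (by omega)) d
    have hx'm : x' m = AdjoinRoot.root f := if_neg (lt_irrefl m)
    refine ⟨AdjoinRoot f, inferInstance, inferInstance, x', ?_, ?_⟩
    · intro i hi
      rcases (Nat.lt_succ_iff.1 hi).lt_or_eq with h | rfl
      · rw [hx' _ h, hx i h, map_zero]
      · have := AdjoinRoot.eval₂_root f
        simp only [f, Polynomial.eval₂_finsetSum, Polynomial.eval₂_mul, Polynomial.eval₂_C,
          Polynomial.eval₂_pow, Polynomial.eval₂_X] at this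
        rw [complHom, ← this]
        refine Finset.sum_congr rfl fun k _ ↦ ?_
        rw [hx' _ le_rfl, hx'm]
        rfl
    · let pb := AdjoinRoot.powerBasis' hmonic
      have hdim : pb.dim = l - m := hnat
      have h := linearIndependent_smul hlin pb.basis.linearIndependent
      let e : {a : Fin (m + 1) → ℕ // ∀ i, a i < l - i.1} →
          {a : Fin m → ℕ // ∀ i, a i < l - i.1} × Fin pb.dim :=
        fun a ↦ (⟨fun i ↦ a.1 i.castSucc, fun i ↦ a.2 i.castSucc⟩,
          ⟨a.1 (Fin.last m), hdim ▸ a.2 (Fin.last m)⟩)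
      have he : Function.Injective e := by
        intro a b hab
        simp only [e, Prod.mk.injEq, Subtype.mk.injEq, Fin.mk.injEq] at hab
        refine Subtype.ext (funext fun i ↦ ?_)
        refine Fin.lastCases hab.2 (fun j ↦ congrFun hab.1 j) i
      convert h.comp e he using 1
      funext a
      simp only [Function.comp_apply, e, pb.basis_eq_pow, Algebra.smul_def, map_prod, map_pow,
        Fin.prod_univ_castSucc, Fin.val_last, Fin.val_castSucc, hx'm]
      congr 1
      exact Finset.prod_congr rfl fun i _ ↦ by simp only [x', if_pos i.2]

end StandardMonomials

/-! ### Divided difference operators -/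

section DividedDifference

open MvPolynomial

variable {K : Type*} [Field K]

/-- The interchange of the variables `X r` and `X (r + 1)`. -/
noncomputable def swapVar (r : ℕ) : MvPolynomial ℕ K →ₐ[K] MvPolynomial ℕ K :=
  rename (Equiv.swap r (r + 1))

@[simp] theorem swapVar_X (r i : ℕ) :
    swapVar r (X i : MvPolynomial ℕ K) = X (Equiv.swap r (r + 1) i) := rename_X _ _

theorem swapVar_X_left (r : ℕ) : swapVar r (X r : MvPolynomial ℕ K) = X (r + 1) := by simp

theorem swapVar_X_right (r : ℕ) : swapVar r (X (r + 1) : MvPolynomial ℕ K) = X r := by simp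

theorem swapVar_X_of_ne {r i : ℕ} (h₁ : i ≠ r) (h₂ : i ≠ r + 1) :
    swapVar r (X i : MvPolynomial ℕ K) = X i := by
  rw [swapVar_X, Equiv.swap_apply_of_ne_of_ne h₁ h₂]

@[simp] theorem swapVar_swapVar (r : ℕ) (f : MvPolynomial ℕ K) : swapVar r (swapVar r f) = f := by
  simp only [swapVar, rename_rename]
  convert rename_id_apply f
  ext i
  simp

theorem swapVar_comm {r q : ℕ} (h : q + 1 < r) (f : MvPolynomial ℕ K) :
    swapVar r (swapVar q f) = swapVar q (swapVar r f) := by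
  simp only [swapVar, rename_rename]
  congr 2
  funext i
  simp only [Function.comp_apply, Equiv.swap_apply_def]
  split_ifs <;> omega

theorem swapVar_braid (r : ℕ) (f : MvPolynomial ℕ K) :
    swapVar r (swapVar (r + 1) (swapVar r f)) =
      swapVar (r + 1) (swapVar r (swapVar (r + 1) f)) := by
  simp only [swapVar, rename_rename]
  have h := Equiv.swap_mul_swap_mul_swap (x := r + 2) (y := r + 1) (z := r) (by omega) (by omega)
  have h' := Equiv.swap_mul_swap_mul_swap (x := r) (y := r + 1) (z := r + 2) (by omega) (by omega)
  rw [Equiv.swap_comm _ r, Equiv.swap_comm (r + 2)] at h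
  rw [Equiv.swap_comm (r + 2) r] at h'
  congr 2
  funext i
  exact DFunLike.congr_fun (h.trans h'.symm) i

theorem X_sub_X_ne_zero {i j : ℕ} (h : i ≠ j) : (X i - X j : MvPolynomial ℕ K) ≠ 0 :=
  sub_ne_zero.2 fun h' ↦ h (X_injective h')

theorem X_sub_X_dvd (r : ℕ) (f : MvPolynomial ℕ K) : X (r + 1) - X r ∣ f - swapVar r f := by
  induction f using MvPolynomial.induction_on with
  | C a => simp [swapVar]
  | add f g hf hg =>
    rw [map_add, add_sub_add_comm]
    exact dvd_add hf hg
  | mul_X f i hf =>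
    have h : (X (r + 1) - X r : MvPolynomial ℕ K) ∣ X i - swapVar r (X i) := by
      rcases eq_or_ne i r with rfl | h₁
      · rw [swapVar_X_left, dvd_sub_comm]
      · rcases eq_or_ne i (r + 1) with rfl | h₂
        · rw [swapVar_X_right]
        · rw [swapVar_X_of_ne h₁ h₂, sub_self]
          exact dvd_zero _
    have e : f * X i - swapVar r (f * X i) =
        (f - swapVar r f) * X i + swapVar r f * (X i - swapVar r (X i)) := by
      rw [map_mul]; ring
    rw [e]
    exact dvd_add (hf.mul_right _) (h.mul_left _)

/-- The divided difference `(f - s_r f) / (X (r + 1) - X r)`. The order of the denominator is the one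
for which `X (r + 1)` is sent to `1`. -/
noncomputable def divDiff (r : ℕ) : MvPolynomial ℕ K →ₗ[K] MvPolynomial ℕ K where
  toFun f := (X_sub_X_dvd r f).choose
  map_add' f g := by
    refine mul_left_cancel₀ (X_sub_X_ne_zero (K := K) (Nat.succ_ne_self r)) ?_
    rw [mul_add, ← (X_sub_X_dvd r (f + g)).choose_spec, ← (X_sub_X_dvd r f).choose_spec,
      ← (X_sub_X_dvd r g).choose_spec, map_add]
    ring
  map_smul' c f := by
    refine mul_left_cancel₀ (X_sub_X_ne_zero (K := K) (Nat.succ_ne_self r)) ?_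
    rw [RingHom.id_apply, mul_smul_comm, ← (X_sub_X_dvd r (c • f)).choose_spec,
      ← (X_sub_X_dvd r f).choose_spec, map_smul, smul_sub]

theorem mul_divDiff (r : ℕ) (f : MvPolynomial ℕ K) :
    (X (r + 1) - X r) * divDiff r f = f - swapVar r f :=
  (X_sub_X_dvd r f).choose_spec.symm

theorem divDiff_eq_of_mul_eq {r : ℕ} {f g : MvPolynomial ℕ K}
    (h : (X (r + 1) - X r) * g = f - swapVar r f) : divDiff r f = g :=
  mul_left_cancel₀ (X_sub_X_ne_zero (Nat.succ_ne_self r)) ((mul_divDiff r f).trans h.symm)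

theorem divDiff_eq_zero {r : ℕ} {f : MvPolynomial ℕ K} (h : swapVar r f = f) :
    divDiff r f = 0 := divDiff_eq_of_mul_eq (by rw [h, mul_zero, sub_self])

theorem divDiff_mul (r : ℕ) (f g : MvPolynomial ℕ K) :
    divDiff r (f * g) = divDiff r f * g + swapVar r f * divDiff r g := by
  apply divDiff_eq_of_mul_eq
  rw [map_mul]
  linear_combination g * mul_divDiff r f + swapVar r f * mul_divDiff r g

theorem divDiff_C (r : ℕ) (a : K) : divDiff r (C a) = 0 :=
  divDiff_eq_zero (by simp [swapVar])

theorem divDiff_X_left (r : ℕ) : divDiff r (X r : MvPolynomial ℕ K) = -1 :=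
  divDiff_eq_of_mul_eq (by rw [swapVar_X_left]; ring)

theorem divDiff_X_right (r : ℕ) : divDiff r (X (r + 1) : MvPolynomial ℕ K) = 1 :=
  divDiff_eq_of_mul_eq (by rw [swapVar_X_right]; ring)

theorem divDiff_X_of_ne {r i : ℕ} (h₁ : i ≠ r) (h₂ : i ≠ r + 1) :
    divDiff r (X i : MvPolynomial ℕ K) = 0 :=
  divDiff_eq_zero (swapVar_X_of_ne h₁ h₂)

theorem swapVar_divDiff (r : ℕ) (f : MvPolynomial ℕ K) :
    swapVar r (divDiff r f) = divDiff r f := by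
  refine (divDiff_eq_of_mul_eq ?_).symm
  have := congrArg (swapVar r) (mul_divDiff r f)
  rw [map_mul, map_sub, map_sub, swapVar_swapVar, swapVar_X_left, swapVar_X_right] at this
  linear_combination -this

theorem divDiff_divDiff (r : ℕ) (f : MvPolynomial ℕ K) : divDiff r (divDiff r f) = 0 :=
  divDiff_eq_zero (swapVar_divDiff r f)

theorem divDiff_comm {r q : ℕ} (h : q + 1 < r) (f : MvPolynomial ℕ K) :
    divDiff r (divDiff q f) = divDiff q (divDiff r f) := by
  have hr := X_sub_X_ne_zero (K := K) (Nat.succ_ne_self r)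
  have hq := X_sub_X_ne_zero (K := K) (Nat.succ_ne_self q)
  have key : ∀ a b : ℕ, (a + 1 < b ∨ b + 1 < a) →
      (X (b + 1) - X b) * ((X (a + 1) - X a) * divDiff a (divDiff b f)) =
        f - swapVar b f - swapVar a f + swapVar a (swapVar b f) := by
    intro a b hab
    have h1 := mul_divDiff a (divDiff b f)
    have h2 := mul_divDiff b f
    have h3 := congrArg (swapVar a) h2
    rw [map_mul, map_sub, map_sub, swapVar_X_of_ne (by omega) (by omega),
      swapVar_X_of_ne (by omega) (by omega)] at h3
    linear_combination (X (b + 1) - X b) * h1 + h2 - h3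
  refine mul_left_cancel₀ hr (mul_left_cancel₀ hq ?_)
  rw [key r q (Or.inr h), mul_left_comm, key q r (Or.inl h), swapVar_comm h]
  ring

/-- Both sides are the antisymmetrization in three variables divided by the Vandermonde product. -/
theorem divDiff_braid (r : ℕ) (f : MvPolynomial ℕ K) :
    divDiff r (divDiff (r + 1) (divDiff r f)) =
      divDiff (r + 1) (divDiff r (divDiff (r + 1) f)) := by
  have h₁ : (X (r + 1) - X r : MvPolynomial ℕ K) ≠ 0 := X_sub_X_ne_zero (by omega)
  have h₂ : (X (r + 2) - X (r + 1) : MvPolynomial ℕ K) ≠ 0 := X_sub_X_ne_zero (by omega)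
  have h₃ : (X (r + 2) - X r : MvPolynomial ℕ K) ≠ 0 := X_sub_X_ne_zero (by omega)
  have x1 : swapVar r (X (r + 2) : MvPolynomial ℕ K) = X (r + 2) :=
    swapVar_X_of_ne (by omega) (by omega)
  have x2 : swapVar (r + 1) (X r : MvPolynomial ℕ K) = X r :=
    swapVar_X_of_ne (by omega) (by omega)
  have x3 : swapVar (r + 1) (X (r + 1) : MvPolynomial ℕ K) = X (r + 2) := swapVar_X_left _
  have x4 : swapVar (r + 1) (X (r + 2) : MvPolynomial ℕ K) = X (r + 1) := swapVar_X_right _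
  refine mul_left_cancel₀ h₁ (mul_left_cancel₀ h₂ (mul_left_cancel₀ h₃ ?_))
  have a1 := mul_divDiff r f
  have a2 := mul_divDiff (r + 1) (divDiff r f)
  have a3 := mul_divDiff r (divDiff (r + 1) (divDiff r f))
  have a4 := congrArg (swapVar r) a2
  have a5 := congrArg (swapVar (r + 1)) a1
  have a6 := congrArg (swapVar r) a5
  have b1 := mul_divDiff (r + 1) f
  have b2 := mul_divDiff r (divDiff (r + 1) f)
  have b3 := mul_divDiff (r + 1) (divDiff r (divDiff (r + 1) f))
  have b4 := congrArg (swapVar (r + 1)) b2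
  have b5 := congrArg (swapVar r) b1
  have b6 := congrArg (swapVar (r + 1)) b5
  simp only [map_mul, map_sub, swapVar_X_left, swapVar_X_right, x1, x2, x3, x4, swapVar_divDiff,
    add_assoc, Nat.reduceAdd] at a2 a4 a5 a6 b1 b2 b3 b4 b5 b6 ⊢
  have hb := swapVar_braid r f
  linear_combination (X (r + 2) - X (r + 1)) * (X (r + 2) - X r) * a3 + (X (r + 2) - X r) * a2
    - (X (r + 2) - X (r + 1)) * a4 + a1 - a5 + a6
    - ((X (r + 1) - X r) * (X (r + 2) - X r) * b3 + (X (r + 2) - X r) * b2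
    - (X (r + 1) - X r) * b4 + b1 - b5 + b6) - hb

theorem swapVar_complHom {r i : ℕ} (h : i ≤ r) (d : ℕ) :
    swapVar r (complHom (X : ℕ → MvPolynomial ℕ K) i d) = complHom X i d := by
  rw [map_complHom]
  exact complHom_congr (fun j hj ↦ swapVar_X_of_ne (by omega) (by omega)) d

theorem divDiff_complHom_last (r d : ℕ) :
    divDiff r (complHom (X : ℕ → MvPolynomial ℕ K) (r + 1) (d + 1)) =
      -complHom X (r + 2) d := by
  apply divDiff_eq_of_mul_eq
  rw [map_complHom]
  have := complHom_sub_complHom (x := (X : ℕ → MvPolynomial ℕ K))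
    (x' := fun j ↦ swapVar r (X j)) (r := r)
    (fun j hj ↦ swapVar_X_of_ne (by omega) (by omega)) (swapVar_X_left r) d
  linear_combination this

theorem divDiff_complHom_of_gt {r i : ℕ} (h : r + 2 ≤ i) (d : ℕ) :
    divDiff r (complHom (X : ℕ → MvPolynomial ℕ K) i d) = 0 := by
  induction i, h using Nat.le_induction generalizing d with
  | base =>
    have := congrArg (divDiff r) (divDiff_complHom_last (K := K) r d)
    rwa [divDiff_divDiff, map_neg, eq_comm, neg_eq_zero] at this
  | succ i hi ih =>
    induction d with
    | zero => simpa using divDiff_C (K := K) r 1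
    | succ d ihd =>
      rw [complHom_succ_succ, map_add, ih, divDiff_mul, ihd,
        divDiff_X_of_ne (by omega) (by omega)]
      simp

end DividedDifference

/-! ### The longest permutation -/

section Longest

variable {n : ℕ}

theorem inversions_revPerm_mul (u : Equiv.Perm (Fin n)) :
    (inversions (Fin.revPerm * u)).card + (inversions u).card =
      (inversions (Fin.revPerm : Equiv.Perm (Fin n))).card := by
  rw [← Finset.card_union_of_disjoint]
  · congr 1
    ext ⟨i, j⟩
    simp only [Finset.mem_union, mem_inversions, Equiv.Perm.mul_apply, Fin.revPerm_apply,
      Fin.rev_lt_rev]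
    refine ⟨fun h ↦ ?_, fun h ↦ ?_⟩
    · rcases h with h | h <;> exact ⟨h.1, h.1⟩
    · rcases lt_or_gt_of_ne (u.injective.ne h.1.ne) with h' | h'
      · exact Or.inl ⟨h.1, h'⟩
      · exact Or.inr ⟨h.1, h'⟩
  · rw [Finset.disjoint_left]
    rintro ⟨i, j⟩
    simp only [mem_inversions, Equiv.Perm.mul_apply, Fin.revPerm_apply, Fin.rev_lt_rev]
    exact fun h h' ↦ lt_asymm h.2 h'.2

theorem wordPerm_reverse (s : List (Fin (n - 1))) : wordPerm s.reverse = (wordPerm s)⁻¹ := by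
  induction s with
  | nil => simp [wordPerm]
  | cons r s ih =>
    rw [List.reverse_cons, wordPerm_append, ih, wordPerm_cons r s, mul_inv_rev, simpleTransp_inv]
    simp [wordPerm]

theorem card_inversions_inv (w : Equiv.Perm (Fin n)) :
    (inversions w⁻¹).card = (inversions w).card := by
  have h : ∀ w : Equiv.Perm (Fin n), (inversions w⁻¹).card ≤ (inversions w).card := by
    intro w
    obtain ⟨s, rfl, hl⟩ := exists_word_length_eq w
    rw [← hl, ← wordPerm_reverse, ← List.length_reverse]
    exact card_inversions_le_length _
  exact le_antisymm (h w) (by simpa using h w⁻¹)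

theorem card_inversions_pos {w : Equiv.Perm (Fin n)} (h : w ≠ 1) : 0 < (inversions w).card := by
  rw [Nat.pos_iff_ne_zero]
  intro h0
  obtain ⟨s, rfl, hl⟩ := exists_word_length_eq w
  rw [List.eq_nil_of_length_eq_zero (hl.trans h0)] at h
  exact h rfl

/-- The word `0, 1, …, m - 2, 0, 1, …, m - 3, …, 0`, a reduced expression of the permutation that
reverses the first `m` positions. -/
def longestWord : ℕ → List ℕ
  | 0 => []
  | m + 1 => List.range m ++ longestWord m

theorem lt_of_mem_longestWord {r m : ℕ} (h : r ∈ longestWord m) : r + 1 < m := by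
  induction m with
  | zero => simp [longestWord] at h
  | succ m ih =>
    rw [longestWord, List.mem_append, List.mem_range] at h
    rcases h with h | h
    · omega
    · exact (ih h).trans m.lt_succ_self

theorem length_longestWord (m : ℕ) : (longestWord m).length = ∑ i ∈ Finset.range m, i := by
  induction m with
  | zero => rfl
  | succ m ih => rw [longestWord, List.length_append, ih, Finset.sum_range_succ, List.length_range,
      add_comm]

theorem card_inversions_revPerm :
    (inversions (Fin.revPerm : Equiv.Perm (Fin n))).card = ∑ i ∈ Finset.range n, i := by
  rw [inversions, Finset.card_filter, Fintype.sum_prod_type_right, ← Fin.sum_univ_eq_sum_range]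
  refine Finset.sum_congr rfl fun j _ ↦ ?_
  rw [← Finset.card_filter, ← Fin.card_Iio]
  congr 1
  ext i
  simp

theorem wordPerm_val (s : List (Fin (n - 1))) (i : Fin n) :
    (wordPerm s i).1 =
      ((s.map Fin.val).map fun r ↦ Equiv.swap r (r + 1)).prod i.1 := by
  induction s generalizing i with
  | nil => rfl
  | cons r s ih =>
    rw [wordPerm_cons, Equiv.Perm.mul_apply, simpleTransp_val, ih]
    simp

theorem prod_swap_range_apply (m i : ℕ) :
    ((List.range m).map fun r ↦ Equiv.swap r (r + 1)).prod i =
      if i < m then i + 1 else if i = m then 0 else i := by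
  induction m generalizing i with
  | zero => simp
  | succ m ih =>
    rw [List.range_succ, List.map_append, List.prod_append, Equiv.Perm.mul_apply, ih]
    simp only [List.map_cons, List.map_nil, List.prod_cons, List.prod_nil, mul_one,
      Equiv.swap_apply_def]
    split_ifs <;> omega

theorem prod_swap_longestWord_apply (m i : ℕ) :
    ((longestWord m).map fun r ↦ Equiv.swap r (r + 1)).prod i =
      if i < m then m - 1 - i else i := by
  induction m generalizing i with
  | zero => simp [longestWord]
  | succ m ih =>
    rw [longestWord, List.map_append, List.prod_append, Equiv.Perm.mul_apply, ih,
      prod_swap_range_apply]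
    split_ifs <;> omega

theorem exists_map_val_eq {t : List ℕ} (h : ∀ r ∈ t, r + 1 < n) :
    ∃ s : List (Fin (n - 1)), s.map Fin.val = t := by
  induction t with
  | nil => exact ⟨[], rfl⟩
  | cons r t ih =>
    obtain ⟨s, hs⟩ := ih fun q hq ↦ h q (List.mem_cons_of_mem _ hq)
    exact ⟨⟨r, by have := h r List.mem_cons_self; omega⟩ :: s, by simp [hs]⟩

end Longest

/-! ### The elements indexed by permutations in an algebra with nilCoxeter relations -/

section PermElem

variable {n : ℕ} {A : Type*} [Ring A]

/-- The product of the elements `p r` along a reduced expression of `w`. -/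
noncomputable def permElem (p : Fin (n - 1) → A) (w : Equiv.Perm (Fin n)) : A :=
  ((exists_isReducedExpr w).choose.map p).prod

variable {p : Fin (n - 1) → A}

theorem IsNilCoxeter.prod_eq_permElem (hp : IsNilCoxeter p) {s : List (Fin (n - 1))}
    (hs : s.length = (inversions (wordPerm s)).card) :
    (s.map p).prod = permElem p (wordPerm s) := by
  have h := (exists_isReducedExpr (wordPerm s)).choose_spec
  exact hp.prod_eq_of_reduced hs h.1.symm (h.length_eq.trans hs.symm)

theorem exists_permElem_eq (p : Fin (n - 1) → A) (w : Equiv.Perm (Fin n)) :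
    ∃ s : List (Fin (n - 1)), wordPerm s = w ∧ s.length = (inversions w).card ∧
      (s.map p).prod = permElem p w :=
  ⟨_, (exists_isReducedExpr w).choose_spec.1, (exists_isReducedExpr w).choose_spec.length_eq, rfl⟩

theorem IsNilCoxeter.prod_eq_zero_or (hp : IsNilCoxeter p) (s : List (Fin (n - 1))) :
    (s.map p).prod = 0 ∨ (s.map p).prod = permElem p (wordPerm s) := by
  rcases (card_inversions_le_length s).lt_or_eq with h | h
  · exact Or.inl (hp.prod_eq_zero h)
  · exact Or.inr (hp.prod_eq_permElem h.symm)

theorem IsNilCoxeter.permElem_revPerm_mul_self (hp : IsNilCoxeter p) (u : Equiv.Perm (Fin n)) :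
    permElem p (Fin.revPerm * u⁻¹) * permElem p u = permElem p Fin.revPerm := by
  obtain ⟨s, hs, hsl, hsp⟩ := exists_permElem_eq p (Fin.revPerm * u⁻¹)
  obtain ⟨t, ht, htl, htp⟩ := exists_permElem_eq p u
  have hst : wordPerm (s ++ t) = Fin.revPerm := by rw [wordPerm_append, hs, ht]; simp
  rw [← hsp, ← htp, ← List.prod_append, ← List.map_append, ← hst]
  apply hp.prod_eq_permElem
  rw [hst, List.length_append, hsl, htl, ← inversions_revPerm_mul u⁻¹, card_inversions_inv u]

theorem IsNilCoxeter.permElem_revPerm_mul_of_ne (hp : IsNilCoxeter p) {u w : Equiv.Perm (Fin n)}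
    (hne : w ≠ u) (hle : (inversions u).card ≤ (inversions w).card) :
    permElem p (Fin.revPerm * u⁻¹) * permElem p w = 0 := by
  obtain ⟨s, hs, hsl, hsp⟩ := exists_permElem_eq p (Fin.revPerm * u⁻¹)
  obtain ⟨t, ht, htl, htp⟩ := exists_permElem_eq p w
  rw [← hsp, ← htp, ← List.prod_append, ← List.map_append]
  apply hp.prod_eq_zero
  -- The concatenated word is at least as long as the longest permutation, but its product is not
  -- the longest permutation.
  have h1 := inversions_revPerm_mul u⁻¹
  have h2 := inversions_revPerm_mul (u⁻¹ * w)
  have h3 := card_inversions_pos (w := u⁻¹ * w) (by rwa [Ne, inv_mul_eq_one, eq_comm])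
  rw [wordPerm_append, hs, ht, List.length_append, hsl, htl, mul_assoc]
  rw [card_inversions_inv] at h1
  omega

end PermElem

/-! ### Algebras with nilHecke relations -/

section NilHeckeRelations

open MvPolynomial

variable {K : Type*} [Field K] {A : Type*} [Ring A] [Algebra K A] {n l : ℕ}

/-- The nilHecke relations for families `p` and `y` indexed by all natural numbers. Only the `p r`
with `r + 1 < n` are constrained. -/
structure IsNilHecke (n : ℕ) (p y : ℕ → A) : Prop where
  sq : ∀ r, r + 1 < n → p r * p r = 0
  comm : ∀ r q, r + 1 < n → q + 1 < r → p r * p q = p q * p r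
  braid : ∀ r, r + 2 < n → p r * p (r + 1) * p r = p (r + 1) * p r * p (r + 1)
  y_comm : ∀ i j, y i * y j = y j * y i
  p_y : ∀ r i, r + 1 < n → i ≠ r → i ≠ r + 1 → p r * y i = y i * p r
  p_y_succ : ∀ r, r + 1 < n → p r * y (r + 1) = y r * p r + 1
  y_succ_p : ∀ r, r + 1 < n → y (r + 1) * p r = p r * y r + 1

variable {p y : ℕ → A}

theorem IsNilHecke.isNilCoxeter (h : IsNilHecke n p y) :
    IsNilCoxeter fun r : Fin (n - 1) ↦ p r.1 where
  sq r := h.sq r (by omega)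
  comm r q hqr := h.comm r q (by omega) hqr
  braid r q hqr := by
    rw [hqr]
    exact h.braid r (by omega)

variable (K) in
theorem exists_aeval_eq (hy : ∀ i j, y i * y j = y j * y i) :
    ∃ φ : MvPolynomial ℕ K →ₐ[K] A, ∀ j, φ (X j) = y j := by
  have : IsMulCommutative (Algebra.adjoin K (Set.range y)) :=
    Algebra.isMulCommutative_adjoin K (by
      rintro _ ⟨i, rfl⟩ _ ⟨j, rfl⟩
      exact hy i j)
  let _ : CommRing (Algebra.adjoin K (Set.range y)) :=
    { (inferInstance : Ring (Algebra.adjoin K (Set.range y))) with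
      mul_comm := this.is_comm.comm }
  let v : ℕ → Algebra.adjoin K (Set.range y) := fun j ↦ ⟨y j, Algebra.subset_adjoin ⟨j, rfl⟩⟩
  exact ⟨(Algebra.adjoin K (Set.range y)).val.comp (aeval v), fun j ↦ by simp [v]⟩

variable {φ : MvPolynomial ℕ K →ₐ[K] A}

theorem map_mul_comm (f g : MvPolynomial ℕ K) : φ f * φ g = φ g * φ f := by
  rw [← map_mul, mul_comm, map_mul]

theorem IsNilHecke.p_mul_map (h : IsNilHecke n p y) (hφ : ∀ j, φ (X j) = y j) {r : ℕ}
    (hr : r + 1 < n) (f : MvPolynomial ℕ K) :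
    p r * φ f = φ (swapVar r f) * p r + φ (divDiff r f) := by
  induction f using MvPolynomial.induction_on with
  | C a =>
    rw [divDiff_C, map_zero, add_zero, ← algebraMap_eq, AlgHom.commutes, AlgHom.commutes,
      AlgHom.commutes, Algebra.commutes]
  | add f g hf hg => rw [map_add, mul_add, hf, hg, map_add, map_add, map_add, map_add]; noncomm_ring
  | mul_X f i hf =>
    have hX : p r * y i = φ (swapVar r (X i)) * p r + φ (divDiff r (X i)) := by
      rcases eq_or_ne i r with rfl | h₁
      · rw [swapVar_X_left, divDiff_X_left, hφ, h.y_succ_p i hr]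
        simp
      · rcases eq_or_ne i (r + 1) with rfl | h₂
        · rw [swapVar_X_right, divDiff_X_right, hφ, h.p_y_succ r hr, map_one]
        · rw [swapVar_X_of_ne h₁ h₂, divDiff_X_of_ne h₁ h₂, hφ, h.p_y r i hr h₁ h₂]
          simp
    rw [map_mul, ← mul_assoc, hf, hφ, add_mul, mul_assoc, hX, divDiff_mul]
    simp only [map_mul, map_add, hφ, mul_add, ← mul_assoc]
    abel

/-- The kernel of the substitution of the `y j` is stable under divided differences. From `φ f = 0`
one gets `φ (∂ f) ψ = ψ φ(f) ψ = 0`, and `ψ y (r + 1) - y r ψ = 1` turns this into `φ (∂ f) = 0`. -/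
theorem IsNilHecke.map_divDiff_eq_zero (h : IsNilHecke n p y) (hφ : ∀ j, φ (X j) = y j) {r : ℕ}
    (hr : r + 1 < n) {f : MvPolynomial ℕ K} (hf : φ f = 0) : φ (divDiff r f) = 0 := by
  have h1 : φ (divDiff r f) * p r = 0 := by
    have := congrArg (· * p r) (h.p_mul_map hφ hr f)
    simpa [hf, add_mul, mul_assoc, h.sq r hr, eq_comm] using this
  have h3 : φ (divDiff r f) * (p r * y (r + 1)) = φ (divDiff r f) * (y r * p r + 1) := by
    rw [h.p_y_succ r hr]
  rw [← mul_assoc, h1, zero_mul, mul_add, mul_one, ← mul_assoc, ← hφ r, map_mul_comm, mul_assoc,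
    h1, mul_zero, zero_add] at h3
  exact h3.symm

theorem IsNilHecke.map_complHom_eq_zero (h : IsNilHecke n p y) (hφ : ∀ j, φ (X j) = y j)
    (hl : n ≤ l) (h0 : 0 < n → y 0 ^ l = 0) {i : ℕ} (hi : i < n) :
    φ (complHom X (i + 1) (l - i)) = 0 := by
  induction i with
  | zero => rw [complHom_one, map_pow, hφ, Nat.sub_zero, h0 hi]
  | succ i ih =>
    have := h.map_divDiff_eq_zero hφ hi (ih (by omega))
    rwa [show l - i = l - (i + 1) + 1 by omega, divDiff_complHom_last, map_neg,
      neg_eq_zero] at this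

/-! ### Cancellation of the element of the longest permutation -/

/-- The word `j, …, m - 1` moves `y m` to `y j`, up to a remainder in which the first letter is
omitted: in all other remainders a letter `i` with `p i * v = 0` commutes to the end. -/
theorem IsNilHecke.prod_range'_mul_y (h : IsNilHecke n p y) {m : ℕ} (hm : m < n) {v : A}
    (hv : ∀ i, i + 1 < m → p i * v = 0) {k j : ℕ} (hjk : j + (k + 1) = m) :
    ((List.range' j (k + 1)).map p).prod * (y m * v) =
      y j * (((List.range' j (k + 1)).map p).prod * v) +
        ((List.range' (j + 1) k).map p).prod * v := by
  induction k generalizing j with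
  | zero =>
    subst hjk
    simp only [List.range'_succ, List.range'_zero, List.map_cons, List.map_nil, List.prod_cons,
      List.prod_nil, mul_one, one_mul, zero_add]
    rw [← mul_assoc, h.p_y_succ j (by omega), add_mul, one_mul, mul_assoc]
  | succ k ih =>
    have hc : Commute (p j) ((List.range' (j + 1 + 1) k).map p).prod := by
      refine Commute.list_prod_right _ _ fun x hx ↦ ?_
      obtain ⟨q, hq, rfl⟩ := List.mem_map.1 hx
      rw [List.mem_range'_1] at hq
      exact (h.comm q j (by omega) (by omega)).symm
    have h0 : p j * (((List.range' (j + 1 + 1) k).map p).prod * v) = 0 := by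
      rw [← mul_assoc, hc.eq, mul_assoc, hv j (by omega), mul_zero]
    rw [List.range'_succ, List.map_cons, List.prod_cons, mul_assoc, ih (by omega), mul_add, h0,
      add_zero, ← mul_assoc, h.p_y_succ j (by omega), add_mul, one_mul, mul_assoc, mul_assoc]

theorem IsNilHecke.eq_zero_of_prod_range' (h : IsNilHecke n p y) {m : ℕ} (hm : m < n) {v : A}
    (hv : ∀ i, i + 1 < m → p i * v = 0) {k j : ℕ} (hjk : j + k = m)
    (h0 : ∀ e : ℕ, ((List.range' j k).map p).prod * (y m ^ e * v) = 0) : v = 0 := by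
  induction k generalizing j with
  | zero => simpa using h0 0
  | succ k ih =>
    refine ih (j := j + 1) (by omega) fun e ↦ ?_
    have hv' : ∀ i, i + 1 < m → p i * (y m ^ e * v) = 0 := by
      intro i hi
      have hc : Commute (p i) (y m) := h.p_y i m (by omega) (by omega) (by omega)
      rw [← mul_assoc, (hc.pow_right e).eq, mul_assoc, hv i hi, mul_zero]
    have := h.prod_range'_mul_y hm hv' hjk
    rwa [← mul_assoc (y m), ← pow_succ', h0, h0, mul_zero, zero_add, eq_comm] at this

theorem IsNilHecke.p_mul_prod_longestWord (h : IsNilHecke n p y) {m i : ℕ} (hm : m ≤ n)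
    (him : i + 1 < m) : p i * ((longestWord m).map p).prod = 0 := by
  obtain ⟨s, hs⟩ := exists_map_val_eq (n := n) (t := longestWord m) fun r hr ↦
    (lt_of_mem_longestWord hr).trans_le hm
  let r : Fin (n - 1) := ⟨i, by omega⟩
  have hw : ∀ j : Fin n, (wordPerm s j).1 = if j.1 < m then m - 1 - j.1 else j.1 := by
    intro j
    rw [wordPerm_val, hs, prod_swap_longestWord_apply]
  have hinv : (wordPerm s)⁻¹ = wordPerm s := by
    rw [inv_eq_iff_mul_eq_one]
    ext j
    rw [Equiv.Perm.mul_apply, hw, hw, Equiv.Perm.one_apply]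
    split_ifs <;> omega
  have hlt : (wordPerm s)⁻¹ (hi r) < (wordPerm s)⁻¹ (lo r) := by
    have h₁ : (hi r).1 < m := him
    have h₂ : (lo r).1 < m := by rw [lo_val]; exact Nat.lt_of_succ_lt him
    rw [hinv, Fin.lt_def, hw, hw, if_pos h₁, if_pos h₂]
    rw [hi_val] at h₁ ⊢
    rw [lo_val]
    omega
  have h1 := card_inversions_of_gt hlt
  have h2 := card_inversions_le_length s
  have := h.isNilCoxeter.prod_eq_zero (s := r :: s)
    (by rw [wordPerm_cons, List.length_cons]; omega)
  rw [← hs]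
  simpa [Function.comp_def] using this

/-- An element annihilated by all `ψ_w₀ f`, with `w₀` the longest permutation and `f` a polynomial in
the `y j`, vanishes. The factors `ψ_0 ⋯ ψ_{m-1}` of `ψ_w₀` are removed one after the other. -/
theorem IsNilHecke.eq_zero_of_prod_longestWord (h : IsNilHecke n p y) (hφ : ∀ j, φ (X j) = y j)
    {m : ℕ} (hm : m ≤ n) {v : A}
    (h0 : ∀ g, ((longestWord m).map p).prod * (φ g * v) = 0) : v = 0 := by
  induction m with
  | zero => simpa [longestWord] using h0 1
  | succ m ih =>
    refine ih (by omega) fun g ↦ ?_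
    have hc : Commute (y m) ((longestWord m).map p).prod := by
      refine Commute.list_prod_right _ _ fun x hx ↦ ?_
      obtain ⟨q, hq, rfl⟩ := List.mem_map.1 hx
      have := lt_of_mem_longestWord hq
      exact (h.p_y q m (by omega) (by omega) (by omega)).symm
    refine h.eq_zero_of_prod_range' (m := m) (by omega) (fun i hi ↦ ?_) (zero_add m) fun e ↦ ?_
    · rw [← mul_assoc, h.p_mul_prod_longestWord (by omega) hi, zero_mul]
    · have := h0 (X m ^ e * g)
      rw [longestWord, List.map_append, List.prod_append, map_mul, map_pow, hφ,
        List.range_eq_range'] at this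
      rw [← mul_assoc (y m ^ e), (hc.pow_left e).eq]
      simpa only [mul_assoc] using this

theorem IsNilHecke.prod_longestWord_eq (h : IsNilHecke n p y) :
    ((longestWord n).map p).prod = permElem (fun r : Fin (n - 1) ↦ p r.1) Fin.revPerm := by
  obtain ⟨s, hs⟩ := exists_map_val_eq (n := n) (t := longestWord n) fun r hr ↦
    lt_of_mem_longestWord hr
  have hw : wordPerm s = Fin.revPerm := by
    ext j
    rw [wordPerm_val, hs, prod_swap_longestWord_apply, if_pos j.2, Fin.revPerm_apply, Fin.val_rev]
    omega
  have := h.isNilCoxeter.prod_eq_permElem (s := s) (by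
    rw [hw, card_inversions_revPerm, ← length_longestWord, ← hs, List.length_map])
  rw [← hw, ← this, ← hs]
  simp [Function.comp_def]

/-- In every algebra with nilHecke relations the elements `ψ_w` are right linearly independent over
the image of the polynomial ring. -/
theorem IsNilHecke.eq_zero_of_sum_permElem (h : IsNilHecke n p y) (hφ : ∀ j, φ (X j) = y j)
    {q : Equiv.Perm (Fin n) → MvPolynomial ℕ K}
    (hq : ∑ w, permElem (fun r : Fin (n - 1) ↦ p r.1) w * φ (q w) = 0) (w : Equiv.Perm (Fin n)) :
    φ (q w) = 0 := by
  classical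
  by_contra hw
  obtain ⟨u, hu, hmin⟩ := Finset.exists_min_image
    (Finset.univ.filter fun w ↦ φ (q w) ≠ 0) (fun w ↦ (inversions w).card) ⟨w, by simpa using hw⟩
  simp only [Finset.mem_filter, Finset.mem_univ, true_and] at hu hmin
  have hc := h.isNilCoxeter
  set P := permElem fun r : Fin (n - 1) ↦ p r.1
  have h1 : P (Fin.revPerm * u⁻¹) * ∑ w, P w * φ (q w) = P Fin.revPerm * φ (q u) := by
    rw [Finset.mul_sum, Finset.sum_eq_single u, ← mul_assoc, hc.permElem_revPerm_mul_self]
    · intro w _ hne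
      by_cases h0 : φ (q w) = 0
      · rw [h0, mul_zero, mul_zero]
      · rw [← mul_assoc, hc.permElem_revPerm_mul_of_ne hne (hmin w h0), zero_mul]
    · simp
  rw [hq, mul_zero] at h1
  refine hu (h.eq_zero_of_prod_longestWord hφ le_rfl fun g ↦ ?_)
  rw [map_mul_comm, ← mul_assoc, h.prod_longestWord_eq, ← h1, zero_mul]

end NilHeckeRelations

/-! ### The action on a quotient of the polynomial ring -/

section Representation

open MvPolynomial

variable (K : Type*) [Field K]

/-- The ideal generated by the complete homogeneous polynomials of degree `l - i` in the variables
`X 0, …, X i`, for `i < n`. -/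
noncomputable def homIdeal (l n : ℕ) : Ideal (MvPolynomial ℕ K) :=
  Ideal.span {g | ∃ i < n, g = complHom X (i + 1) (l - i)}

/-- `homIdeal` as a subspace. -/
noncomputable def homSubspace (l n : ℕ) : Submodule K (MvPolynomial ℕ K) :=
  (homIdeal K l n).restrictScalars K

variable {K} {l n : ℕ}

theorem mul_mem_homSubspace (f : MvPolynomial ℕ K) :
    homSubspace K l n ≤ (homSubspace K l n).comap (LinearMap.mulLeft K f) :=
  fun _ hg ↦ (homIdeal K l n).mul_mem_left f hg

theorem divDiff_mem_homSubspace (hl : n ≤ l) {r : ℕ} (hr : r + 1 < n) :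
    homSubspace K l n ≤ (homSubspace K l n).comap (divDiff r) := by
  intro f hf
  change divDiff r f ∈ homIdeal K l n
  change f ∈ homIdeal K l n at hf
  induction hf using Submodule.span_induction with
  | mem g hg =>
    obtain ⟨i, hi, rfl⟩ := hg
    rcases lt_trichotomy i r with h | rfl | h
    · rw [divDiff_eq_zero (swapVar_complHom h _)]
      exact zero_mem _
    · rw [show l - i = l - (i + 1) + 1 by omega, divDiff_complHom_last]
      exact neg_mem (Ideal.subset_span ⟨i + 1, hr, rfl⟩)
    · rw [divDiff_complHom_of_gt (by omega)]
      exact zero_mem _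
  | zero => simp
  | add f g _ _ h h' => rw [map_add]; exact add_mem h h'
  | smul a g hg h =>
    rw [smul_eq_mul, divDiff_mul]
    exact add_mem (Ideal.mul_mem_left _ _ hg) (Ideal.mul_mem_left _ _ h)

/-- Multiplication by `f` on the quotient by `homSubspace`. -/
noncomputable def quotMul (l n : ℕ) (f : MvPolynomial ℕ K) :
    Module.End K (MvPolynomial ℕ K ⧸ homSubspace K l n) :=
  (homSubspace K l n).mapQ _ (LinearMap.mulLeft K f) (mul_mem_homSubspace f)

open Classical in
/-- The divided difference on the quotient by `homSubspace`; zero if it does not descend. -/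
noncomputable def quotDivDiff (l n r : ℕ) :
    Module.End K (MvPolynomial ℕ K ⧸ homSubspace K l n) :=
  if h : homSubspace K l n ≤ (homSubspace K l n).comap (divDiff r) then
    (homSubspace K l n).mapQ _ (divDiff r) h else 0

theorem quotMul_mk (f g : MvPolynomial ℕ K) :
    quotMul l n f ((homSubspace K l n).mkQ g) = (homSubspace K l n).mkQ (f * g) := rfl

theorem quotDivDiff_mk (hl : n ≤ l) {r : ℕ} (hr : r + 1 < n) (g : MvPolynomial ℕ K) :
    quotDivDiff l n r ((homSubspace K l n).mkQ g) = (homSubspace K l n).mkQ (divDiff r g) := by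
  rw [quotDivDiff, dif_pos (divDiff_mem_homSubspace hl hr)]
  rfl

theorem quot_ext {S T : Module.End K (MvPolynomial ℕ K ⧸ homSubspace K l n)}
    (h : ∀ g, S ((homSubspace K l n).mkQ g) = T ((homSubspace K l n).mkQ g)) : S = T :=
  Submodule.linearMap_qext _ (LinearMap.ext h)

theorem isNilHecke_quot (hl : n ≤ l) :
    IsNilHecke n (quotDivDiff (K := K) l n) fun j ↦ quotMul l n (X j) where
  sq r hr := quot_ext fun g ↦ by
    simp only [Module.End.mul_apply, quotDivDiff_mk hl hr, divDiff_divDiff, map_zero,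
      LinearMap.zero_apply]
  comm r q hr hq := quot_ext fun g ↦ by
    simp only [Module.End.mul_apply, quotDivDiff_mk hl hr, quotDivDiff_mk hl (by omega : q + 1 < n),
      divDiff_comm hq]
  braid r hr := quot_ext fun g ↦ by
    simp only [Module.End.mul_apply, quotDivDiff_mk hl (by omega : r + 1 < n),
      quotDivDiff_mk hl (by omega : r + 1 + 1 < n), divDiff_braid]
  y_comm i j := quot_ext fun g ↦ by
    simp only [Module.End.mul_apply, quotMul_mk, mul_left_comm]
  p_y r i hr h₁ h₂ := quot_ext fun g ↦ by
    simp only [Module.End.mul_apply, quotMul_mk, quotDivDiff_mk hl hr, divDiff_mul,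
      divDiff_X_of_ne h₁ h₂, swapVar_X_of_ne h₁ h₂, zero_mul, zero_add]
  p_y_succ r hr := quot_ext fun g ↦ by
    simp only [Module.End.mul_apply, quotMul_mk, quotDivDiff_mk hl hr, divDiff_mul,
      divDiff_X_right, swapVar_X_right, one_mul, LinearMap.add_apply, Module.End.one_apply,
      map_add, add_comm]
  y_succ_p r hr := quot_ext fun g ↦ by
    simp only [Module.End.mul_apply, quotMul_mk, quotDivDiff_mk hl hr, divDiff_mul,
      divDiff_X_left, swapVar_X_left, neg_mul, one_mul, LinearMap.add_apply, Module.End.one_apply,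
      map_add, map_neg, neg_add_cancel_comm]

theorem quotMul_pow_eq_zero (hn : 0 < n) : quotMul (K := K) l n (X 0) ^ l = 0 := by
  have h : ∀ (k : ℕ) (g : MvPolynomial ℕ K), (quotMul l n (X 0) ^ k)
      ((homSubspace K l n).mkQ g) = (homSubspace K l n).mkQ (X 0 ^ k * g) := by
    intro k
    induction k with
    | zero => simp
    | succ k ih => intro g; rw [pow_succ', Module.End.mul_apply, ih, quotMul_mk, pow_succ', mul_assoc]
  refine quot_ext fun g ↦ ?_
  rw [h, LinearMap.zero_apply, Submodule.mkQ_apply, Submodule.Quotient.mk_eq_zero]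
  refine (homIdeal K l n).mul_mem_right g (Ideal.subset_span ⟨0, hn, ?_⟩)
  rw [complHom_one, Nat.sub_zero]

theorem prod_quotMul_mk (L : List (MvPolynomial ℕ K)) (g : MvPolynomial ℕ K) :
    (L.map (quotMul l n)).prod ((homSubspace K l n).mkQ g) =
      (homSubspace K l n).mkQ (L.prod * g) := by
  induction L with
  | nil => simp
  | cons f L ih =>
    rw [List.map_cons, List.prod_cons, Module.End.mul_apply, ih, quotMul_mk, List.prod_cons,
      mul_assoc]

theorem quotMul_pow (f : MvPolynomial ℕ K) (k : ℕ) : quotMul l n (f ^ k) = quotMul l n f ^ k := by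
  induction k with
  | zero => exact quot_ext fun g ↦ by rw [quotMul_mk, pow_zero, pow_zero, one_mul]; rfl
  | succ k ih =>
    refine quot_ext fun g ↦ ?_
    rw [pow_succ', pow_succ', ← ih, Module.End.mul_apply, quotMul_mk, quotMul_mk, quotMul_mk,
      mul_assoc]

end Representation

/-! ### Spanning and independence over the polynomials in the commuting generators -/

section Generation

open MvPolynomial

variable {K : Type*} [Field K] {A : Type*} [Ring A] [Algebra K A] {n l : ℕ} {p y : ℕ → A}
  {φ : MvPolynomial ℕ K →ₐ[K] A}

theorem prod_ofFn_pow_eq_map (hφ : ∀ j, φ (X j) = y j) (a : Fin n → ℕ) :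
    (List.ofFn fun i : Fin n ↦ y i.1 ^ a i).prod = φ (∏ i : Fin n, X i.1 ^ a i) := by
  rw [← List.prod_ofFn, map_list_prod, List.map_ofFn]
  congr 2
  funext i
  simp [hφ]

/-- The reduction of polynomials in the `y j` to bounded monomials, by means of the complete
homogeneous relations. -/
theorem IsNilHecke.map_mem_span_monomials (h : IsNilHecke n p y) (hφ : ∀ j, φ (X j) = y j)
    (hl : n ≤ l) (h0 : 0 < n → y 0 ^ l = 0) (hy : ∀ j, n ≤ j → y j = 0) (f : MvPolynomial ℕ K) :
    φ f ∈ Submodule.span K (Set.range fun a : {a : Fin n → ℕ // ∀ i, a i ≤ l - (i.1 + 1)} ↦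
      (List.ofFn fun i : Fin n ↦ y i.1 ^ a.1 i).prod) := by
  let mk := Ideal.Quotient.mkₐ K (RingHom.ker φ)
  have hadj : mk f ∈ Algebra.adjoin K ((fun j ↦ mk (X j)) '' Set.Iio n) := by
    induction f using MvPolynomial.induction_on with
    | C a =>
      rw [← algebraMap_eq, AlgHom.commutes]
      exact Subalgebra.algebraMap_mem _ a
    | add f g hf hg => rw [map_add]; exact add_mem hf hg
    | mul_X f j hf =>
      rw [map_mul]
      refine mul_mem hf ?_
      by_cases hj : j < n
      · exact Algebra.subset_adjoin ⟨j, hj, rfl⟩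
      · have h0 : mk (X j) = 0 := Ideal.Quotient.eq_zero_iff_mem.2 (by
          rw [RingHom.mem_ker, hφ, hy j (not_lt.1 hj)])
        rw [h0]
        exact zero_mem _
  have hspan := mem_span_isStdMonomial K (fun j ↦ mk (X j)) hl (fun i hi ↦ by
    rw [← map_complHom]
    exact Ideal.Quotient.eq_zero_iff_mem.2 (h.map_complHom_eq_zero hφ hl h0 hi)) hadj
  let ψ : MvPolynomial ℕ K ⧸ RingHom.ker φ →ₐ[K] A :=
    Ideal.Quotient.liftₐ (RingHom.ker φ) φ fun a ha ↦ ha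
  have hψ : ∀ g, ψ (mk g) = φ g := fun g ↦ rfl
  have := Submodule.mem_map_of_mem (f := ψ.toLinearMap) hspan
  rw [AlgHom.toLinearMap_apply, hψ, Submodule.map_span] at this
  refine Submodule.span_mono ?_ this
  rintro _ ⟨_, ⟨a, ha, rfl⟩, rfl⟩
  refine ⟨⟨fun i ↦ a i, fun i ↦ Nat.le_sub_of_add_le ?_⟩, ?_⟩
  · have := ha i i.2
    change a i + (i + 1) ≤ l
    omega
  · simp only [← map_pow, ← map_prod, AlgHom.toLinearMap_apply, hψ, prod_ofFn_pow_eq_map hφ]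
    rw [Finset.prod_range]

/-- The products of a word in the `p r` with a polynomial in the `y j` span: the `y j` move to the
right past each letter, up to products with a shorter word. -/
theorem IsNilHecke.mem_span_word_mul_map (h : IsNilHecke n p y) (hφ : ∀ j, φ (X j) = y j) {z : A}
    (hz : z ∈ Algebra.adjoin K
      (Set.range (fun r : Fin (n - 1) ↦ p r.1) ∪ Set.range fun i : Fin n ↦ y i.1)) :
    z ∈ Submodule.span K
      {z | ∃ (s : List (Fin (n - 1))) (f : _), z = (s.map fun r ↦ p r.1).prod * φ f} := by
  set N := Submodule.span K
    {z | ∃ (s : List (Fin (n - 1))) (f : _), z = (s.map fun r ↦ p r.1).prod * φ f} with hN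
  have hmem : ∀ (s : List (Fin (n - 1))) f, (s.map fun r ↦ p r.1).prod * φ f ∈ N :=
    fun s f ↦ Submodule.subset_span ⟨s, f, rfl⟩
  have hext : ∀ a : A, (∀ (s : List (Fin (n - 1))) f,
      a * ((s.map fun r ↦ p r.1).prod * φ f) ∈ N) → ∀ z ∈ N, a * z ∈ N := by
    intro a ha z hz
    induction hz using Submodule.span_induction with
    | mem z hz => obtain ⟨s, f, rfl⟩ := hz; exact ha s f
    | zero => simp
    | add z z' _ _ h h' => rw [mul_add]; exact add_mem h h'
    | smul c z _ h => rw [mul_smul_comm]; exact Submodule.smul_mem _ _ h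
  have hp : ∀ r : Fin (n - 1), ∀ z ∈ N, p r.1 * z ∈ N := fun r ↦ hext _ fun s f ↦ by
    simpa [mul_assoc] using hmem (r :: s) f
  have hy' : ∀ (s : List (Fin (n - 1))) f j, y j * ((s.map fun r ↦ p r.1).prod * φ f) ∈ N := by
    intro s f
    induction s with
    | nil =>
      intro j
      have := hmem [] (X j * f)
      rw [map_mul, hφ] at this
      simpa using this
    | cons r s ih =>
      intro j
      rw [List.map_cons, List.prod_cons, mul_assoc, ← mul_assoc (y j)]
      rcases eq_or_ne j r.1 with rfl | h₁
      · rw [eq_sub_of_add_eq (h.p_y_succ r.1 (by omega)).symm, sub_mul, one_mul, mul_assoc]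
        exact sub_mem (hp r _ (ih _)) (hmem s f)
      · rcases eq_or_ne j (r.1 + 1) with rfl | h₂
        · rw [h.y_succ_p r.1 (by omega), add_mul, one_mul, mul_assoc]
          exact add_mem (hp r _ (ih _)) (hmem s f)
        · rw [← h.p_y r.1 j (by omega) h₁ h₂, mul_assoc]
          exact hp r _ (ih _)
  have hall : ∀ z' ∈ N, z * z' ∈ N := by
    induction hz using Algebra.adjoin_induction with
    | mem a ha =>
      rcases ha with ⟨r, rfl⟩ | ⟨i, rfl⟩
      · exact hp r
      · exact hext _ fun s f ↦ hy' s f i.1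
    | algebraMap c =>
      intro z hz
      rw [← Algebra.smul_def]
      exact Submodule.smul_mem _ _ hz
    | add a b _ _ ha hb =>
      intro z hz
      rw [add_mul]
      exact add_mem (ha z hz) (hb z hz)
    | mul a b _ _ ha hb =>
      intro z hz
      rw [mul_assoc]
      exact ha _ (hb z hz)
  simpa using hall 1 (by simpa using hmem [] 1)

theorem IsNilHecke.mem_span_permElem_mul (h : IsNilHecke n p y) (hl : n ≤ l)
    (h0 : 0 < n → y 0 ^ l = 0) (hy : ∀ j, n ≤ j → y j = 0) {z : A}
    (hz : z ∈ Algebra.adjoin K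
      (Set.range (fun r : Fin (n - 1) ↦ p r.1) ∪ Set.range fun i : Fin n ↦ y i.1)) :
    z ∈ Submodule.span K (Set.range
      fun b : Equiv.Perm (Fin n) × {a : Fin n → ℕ // ∀ i : Fin n, a i ≤ l - (i.1 + 1)} ↦
        permElem (fun r : Fin (n - 1) ↦ p r.1) b.1 *
          (List.ofFn fun i : Fin n ↦ y i.1 ^ b.2.1 i).prod) := by
  obtain ⟨φ, hφ⟩ := exists_aeval_eq K h.y_comm
  refine Submodule.span_le.2 ?_ (h.mem_span_word_mul_map hφ hz)
  rintro _ ⟨s, f, rfl⟩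
  rcases h.isNilCoxeter.prod_eq_zero_or s with hs | hs
  · rw [hs, zero_mul]
    exact zero_mem _
  · rw [hs]
    generalize hg : φ f = g
    have hf := h.map_mem_span_monomials hφ hl h0 hy f
    rw [hg] at hf
    clear hg
    induction hf using Submodule.span_induction with
    | mem z hz => obtain ⟨a, rfl⟩ := hz; exact Submodule.subset_span ⟨(_, a), rfl⟩
    | zero => simp
    | add z z' _ _ h h' => rw [mul_add]; exact add_mem h h'
    | smul c z _ h => rw [mul_smul_comm]; exact Submodule.smul_mem _ _ h

theorem IsNilHecke.linearIndependent_permElem_mul (h : IsNilHecke n p y)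
    (hlin : LinearIndependent K fun a : {a : Fin n → ℕ // ∀ i, a i ≤ l - (i.1 + 1)} ↦
      (List.ofFn fun i : Fin n ↦ y i.1 ^ a.1 i).prod) :
    LinearIndependent K
      fun b : Equiv.Perm (Fin n) × {a : Fin n → ℕ // ∀ i : Fin n, a i ≤ l - (i.1 + 1)} ↦
        permElem (fun r : Fin (n - 1) ↦ p r.1) b.1 *
          (List.ofFn fun i : Fin n ↦ y i.1 ^ b.2.1 i).prod := by
  obtain ⟨φ, hφ⟩ := exists_aeval_eq K h.y_comm
  have : Finite {a : Fin n → ℕ // ∀ i : Fin n, a i ≤ l - (i.1 + 1)} :=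
    Set.finite_Iic fun i : Fin n ↦ l - (i.1 + 1)
  have := Fintype.ofFinite {a : Fin n → ℕ // ∀ i : Fin n, a i ≤ l - (i.1 + 1)}
  rw [Fintype.linearIndependent_iff]
  rintro c hc ⟨w, a⟩
  have hq : ∀ w, φ (∑ a, c (w, a) • ∏ i : Fin n, X i.1 ^ a.1 i) =
      ∑ a, c (w, a) • (List.ofFn fun i : Fin n ↦ y i.1 ^ a.1 i).prod := fun w ↦ by
    simp only [map_sum, map_smul, prod_ofFn_pow_eq_map hφ]
  have h0 := h.eq_zero_of_sum_permElem hφ (q := fun w ↦ ∑ a, c (w, a) • ∏ i : Fin n, X i.1 ^ a.1 i)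
    (by
      rw [← hc, Fintype.sum_prod_type]
      refine Finset.sum_congr rfl fun w _ ↦ ?_
      rw [hq, Finset.mul_sum]
      exact Finset.sum_congr rfl fun a _ ↦ mul_smul_comm _ _ _) w
  rw [hq] at h0
  exact Fintype.linearIndependent_iff.1 hlin _ h0 a

end Generation

/-! ### The cyclotomic nilHecke algebra -/

section Cyclotomic

open MvPolynomial

variable (K : Type*) [Field K] {l n : ℕ}

/-- A finite family, continued by zero. -/
def extendFin {A : Type*} [Zero A] {m : ℕ} (f : Fin m → A) (r : ℕ) : A :=
  if h : r < m then f ⟨r, h⟩ else 0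

theorem extendFin_of_lt {A : Type*} [Zero A] {m : ℕ} (f : Fin m → A) {r : ℕ} (h : r < m) :
    extendFin f r = f ⟨r, h⟩ := dif_pos h

@[simp] theorem extendFin_val {A : Type*} [Zero A] {m : ℕ} (f : Fin m → A) (r : Fin m) :
    extendFin f r.1 = f r := dif_pos r.2

variable {K} in
theorem proj_eq_of_rel {f g : FreeAlgebra K (Gen n)} (h : Rel K n f g) :
    proj K l n (RingQuot.mkAlgHom K (Rel K n) f) = proj K l n (RingQuot.mkAlgHom K (Rel K n) g) :=
  congrArg _ (RingQuot.mkAlgHom_rel K h)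

theorem y_mul_y (i j : Fin n) : y K l i * y K l j = y K l j * y K l i := by
  simpa using! proj_eq_of_rel (l := l) (Rel.y_comm (K := K) i j)

theorem isNilHecke_cyc (l n : ℕ) :
    IsNilHecke n (extendFin (psi K l (n := n))) (extendFin (y K l (n := n))) where
  sq r hr := by
    rw [extendFin_of_lt _ (by omega)]
    simpa using! proj_eq_of_rel (l := l) (Rel.psi_sq (K := K) (⟨r, by omega⟩ : Fin (n - 1)))
  comm r q hr hq := by
    rw [extendFin_of_lt _ (by omega : r < n - 1), extendFin_of_lt _ (by omega : q < n - 1)]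
    simpa using! proj_eq_of_rel (l := l) (Rel.psi_comm (K := K)
      (⟨r, by omega⟩ : Fin (n - 1)) ⟨q, by omega⟩ hq)
  braid r hr := by
    rw [extendFin_of_lt _ (by omega : r < n - 1), extendFin_of_lt _ (by omega : r + 1 < n - 1)]
    simpa using! proj_eq_of_rel (l := l) (Rel.braid (K := K)
      (⟨r, by omega⟩ : Fin (n - 1)) ⟨r + 1, by omega⟩ rfl)
  y_comm i j := by
    simp only [extendFin]
    split_ifs
    · exact y_mul_y K _ _
    all_goals simp
  p_y r i hr h₁ h₂ := by
    rw [extendFin_of_lt _ (by omega : r < n - 1)]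
    by_cases hi : i < n
    · rw [extendFin_of_lt _ hi]
      simpa using! proj_eq_of_rel (l := l) (Rel.psi_y (K := K)
        (⟨r, by omega⟩ : Fin (n - 1)) ⟨i, hi⟩ (by simpa [Fin.ext_iff] using h₁)
        (by simpa [Fin.ext_iff] using h₂))
    · simp [extendFin, hi]
  p_y_succ r hr := by
    rw [extendFin_of_lt _ (by omega : r < n - 1), extendFin_of_lt _ hr,
      extendFin_of_lt _ (by omega : r < n)]
    simpa using! proj_eq_of_rel (l := l)
      (Rel.psi_y_hi (K := K) (⟨r, by omega⟩ : Fin (n - 1)))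
  y_succ_p r hr := by
    rw [extendFin_of_lt _ (by omega : r < n - 1), extendFin_of_lt _ hr,
      extendFin_of_lt _ (by omega : r < n)]
    simpa using! proj_eq_of_rel (l := l)
      (Rel.y_hi_psi (K := K) (⟨r, by omega⟩ : Fin (n - 1)))

theorem extendFin_y_pow (hn : 0 < n) : extendFin (y K l (n := n)) 0 ^ l = 0 := by
  rw [extendFin_of_lt _ hn]
  have := RingQuot.mkAlgHom_rel K (CycRel.cyc (K := K) (l := l) (⟨0, hn⟩ : Fin n) rfl)
  simpa using! this

variable {K} in
theorem exists_lift {A : Type*} [Ring A] [Algebra K A] {p y' : ℕ → A} (h : IsNilHecke n p y')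
    (h0 : 0 < n → y' 0 ^ l = 0) :
    ∃ ρ : Cyc K l n →ₐ[K] A, ∀ i : Fin n, ρ (y K l i) = y' i := by
  let f : FreeAlgebra K (Gen n) →ₐ[K] A := FreeAlgebra.lift K fun
    | Gen.psi r => p r.1
    | Gen.y i => y' i.1
  have hp : ∀ r, f (freePsi K r) = p r.1 := fun r ↦ FreeAlgebra.lift_ι_apply _ _
  have hy : ∀ i, f (freeY K i) = y' i.1 := fun i ↦ FreeAlgebra.lift_ι_apply _ _
  have hf : ∀ ⦃a b⦄, Rel K n a b → f a = f b := by
    intro a b hab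
    cases hab with
    | psi_sq r => simpa [hp] using h.sq r.1 (by omega)
    | psi_comm r k hk => simpa [hp] using h.comm r.1 k.1 (by omega) hk
    | braid r k hk => simpa [hp, hk] using h.braid r.1 (by omega)
    | y_comm i k => simpa [hy] using h.y_comm i.1 k.1
    | psi_y r k h₁ h₂ =>
      simpa [hp, hy] using h.p_y r.1 k.1 (by omega) (fun e ↦ h₁ (Fin.ext e))
        (fun e ↦ h₂ (Fin.ext e))
    | psi_y_hi r => simpa [hp, hy] using h.p_y_succ r.1 (by omega)
    | y_hi_psi r => simpa [hp, hy] using h.y_succ_p r.1 (by omega)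
  let g : Alg K n →ₐ[K] A := RingQuot.liftAlgHom K ⟨f, hf⟩
  have hg : ∀ i, g (algY K i) = y' i.1 := fun i ↦
    (RingQuot.liftAlgHom_mkAlgHom_apply K f hf _).trans (hy i)
  have hgr : ∀ ⦃a b⦄, CycRel K l n a b → g a = g b := by
    intro a b hab
    cases hab with
    | cyc i hi => rw [map_pow, hg, hi, map_zero, h0 (by omega)]
  exact ⟨RingQuot.liftAlgHom K ⟨g, hgr⟩, fun i ↦
    (RingQuot.liftAlgHom_mkAlgHom_apply K g hgr _).trans (hg i)⟩

/-- The bounded monomials in the `y i` are linearly independent. They act on the class of `1` in the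
quotient of the polynomial ring by `homIdeal` as the standard monomials. -/
theorem linearIndependent_yMonomial (hl : n ≤ l) :
    LinearIndependent K fun a : {a : Fin n → ℕ // ∀ i, a i ≤ l - (i.1 + 1)} ↦
      yMonomial K l a.1 := by
  obtain ⟨ρ, hρ⟩ : ∃ ρ : Cyc K l n →ₐ[K] Module.End K (MvPolynomial ℕ K ⧸ homSubspace K l n),
      ∀ i : Fin n, ρ (y K l i) = quotMul l n (X i.1) :=
    exists_lift (isNilHecke_quot hl) quotMul_pow_eq_zero
  obtain ⟨R, _, _, x, hx, hlin⟩ := exists_linearIndependent_stdMonomials (K := K) hl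
  have hker : homSubspace K l n ≤ LinearMap.ker (aeval (R := K) x).toLinearMap := by
    have : homIdeal K l n ≤ RingHom.ker (aeval (R := K) x) := by
      refine Ideal.span_le.2 ?_
      rintro _ ⟨i, hi, rfl⟩
      rw [SetLike.mem_coe, RingHom.mem_ker, map_complHom]
      simpa using hx i hi
    exact fun f hf ↦ this hf
  let T : Cyc K l n →ₗ[K] R := (homSubspace K l n).liftQ _ hker ∘ₗ
    LinearMap.applyₗ ((homSubspace K l n).mkQ 1) ∘ₗ ρ.toLinearMap
  have hT : ∀ a : Fin n → ℕ, T (yMonomial K l a) = ∏ i : Fin n, x i ^ a i := by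
    intro a
    have h1 : ρ (yMonomial K l a) =
        ((List.ofFn fun i : Fin n ↦ (X i.1 ^ a i : MvPolynomial ℕ K)).map (quotMul l n)).prod := by
      rw [yMonomial, map_list_prod, List.map_ofFn, List.map_ofFn]
      congr 2
      funext i
      simp [hρ, quotMul_pow]
    have h2 : T (yMonomial K l a) = (homSubspace K l n).liftQ _ hker
        (ρ (yMonomial K l a) ((homSubspace K l n).mkQ 1)) := rfl
    rw [h2, h1, prod_quotMul_mk, Submodule.mkQ_apply, Submodule.liftQ_apply, mul_one,
      List.prod_ofFn]
    simp
  refine LinearIndependent.of_comp T ?_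
  let e : {a : Fin n → ℕ // ∀ i, a i ≤ l - (i.1 + 1)} → {a : Fin n → ℕ // ∀ i, a i < l - i.1} :=
    fun a ↦ ⟨a.1, fun i ↦ by have := a.2 i; omega⟩
  have he : Function.Injective e := fun a b hab ↦ Subtype.ext (Subtype.mk.inj hab)
  convert hlin.comp e he using 1
  funext a
  exact hT a.1

theorem adjoin_psi_y (l n : ℕ) :
    Algebra.adjoin K (Set.range (psi K l (n := n)) ∪ Set.range (y K l)) = ⊤ := by
  refine top_le_iff.1 fun z _ ↦ ?_
  obtain ⟨b, rfl⟩ := RingQuot.mkAlgHom_surjective K (CycRel K l n) z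
  obtain ⟨a, rfl⟩ := RingQuot.mkAlgHom_surjective K (Rel K n) b
  change proj K l n (RingQuot.mkAlgHom K (Rel K n) a) ∈ _
  induction a using FreeAlgebra.induction with
  | grade0 c =>
    rw [AlgHom.commutes, AlgHom.commutes]
    exact Subalgebra.algebraMap_mem _ c
  | grade1 g =>
    cases g with
    | psi r => exact Algebra.subset_adjoin (Or.inl ⟨r, rfl⟩)
    | y i => exact Algebra.subset_adjoin (Or.inr ⟨i, rfl⟩)
  | mul a b ha hb =>
    rw [map_mul, map_mul]
    exact mul_mem (ha trivial) (hb trivial)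
  | add a b ha hb =>
    rw [map_add, map_add]
    exact add_mem (ha trivial) (hb trivial)

theorem permElem_extendFin_psi (w : Equiv.Perm (Fin n)) :
    permElem (fun r : Fin (n - 1) ↦ extendFin (psi K l) r.1) w = psiPerm K l w := by
  simp only [extendFin_val]
  rfl

theorem prod_ofFn_extendFin_y (a : Fin n → ℕ) :
    (List.ofFn fun i : Fin n ↦ extendFin (y K l) i.1 ^ a i).prod = yMonomial K l a := by
  simp only [extendFin_val]
  rfl

theorem isNilCoxeter_psi (l n : ℕ) : IsNilCoxeter (psi K l (n := n)) := by
  simpa using (isNilHecke_cyc K l n).isNilCoxeter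

theorem psiPerm_eq_psiWord {w : Equiv.Perm (Fin n)} {s : List (Fin (n - 1))}
    (h : IsReducedExpr s w) : psiPerm K l w = psiWord K l s := by
  have := (isNilCoxeter_psi K l n).prod_eq_permElem (s := s) (by rw [h.length_eq, h.1])
  rw [h.1] at this
  exact this.symm

theorem linearIndependent_psiPerm_mul_yMonomial (hl : n ≤ l) :
    LinearIndependent K
      fun b : Equiv.Perm (Fin n) × {a : Fin n → ℕ // ∀ i : Fin n, a i ≤ l - (i.1 + 1)} ↦
        psiPerm K l b.1 * yMonomial K l b.2.1 := by
  have h := (isNilHecke_cyc K l n).linearIndependent_permElem_mul (K := K) (l := l)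
  simp only [permElem_extendFin_psi, prod_ofFn_extendFin_y] at h
  exact h (linearIndependent_yMonomial K hl)

theorem span_psiPerm_mul_yMonomial (hl : n ≤ l) :
    ⊤ ≤ Submodule.span K (Set.range
      fun b : Equiv.Perm (Fin n) × {a : Fin n → ℕ // ∀ i : Fin n, a i ≤ l - (i.1 + 1)} ↦
        psiPerm K l b.1 * yMonomial K l b.2.1) := by
  intro z _
  have h := (isNilHecke_cyc K l n).mem_span_permElem_mul (K := K) hl (extendFin_y_pow K)
    (fun j hj ↦ dif_neg hj.not_gt) (z := z)
  simp only [extendFin_val] at h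
  exact h (by rw [adjoin_psi_y]; trivial)

end Cyclotomic

end NilHecke

theorem mainTheorem1 (K : Type*) [Field K] (l n : ℕ) (hn : n ≤ l) :
    (∀ (w : Equiv.Perm (Fin n)) (s : List (Fin (n - 1))), NilHecke.IsReducedExpr s w →
      NilHecke.psiPerm K l w = NilHecke.psiWord K l s) ∧
    ∃ b : Module.Basis
        (Equiv.Perm (Fin n) × {a : Fin n → ℕ // ∀ i : Fin n, a i ≤ l - (i.1 + 1)})
        K (NilHecke.Cyc K l n),
      ∀ (w : Equiv.Perm (Fin n)) (a : {a : Fin n → ℕ // ∀ i : Fin n, a i ≤ l - (i.1 + 1)}),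
        b (w, a) = NilHecke.psiPerm K l w * NilHecke.yMonomial K l a.1 :=
  ⟨fun _ _ h ↦ NilHecke.psiPerm_eq_psiWord K h,
    Module.Basis.mk (NilHecke.linearIndependent_psiPerm_mul_yMonomial K hn)
      (NilHecke.span_psiPerm_mul_yMonomial K hn),
    fun _ _ ↦ Module.Basis.mk_apply _ _ _⟩
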